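/- Fix countably infinite sets of constants, of nulls and of variables, and countably many relation symbols of each arity $k\ge 1$. An instance is a finite set of relational atoms whose arguments are constants and nulls; a homomorphism between instances is a map on their elements that is the identity on constants and sends atoms to atoms. A core of an instance $I$ is a subset $C\subseteq I$ into which $I$ has a homomorphism and such that no endomorphism of $C$ has an image strictly contained in $C$. A tuple generating dependency (tgd) is a formula $\forall\bar x,\bar y\,(\alpha(\bar x,\bar y)\rightarrow\exists\bar z\,\beta(\bar x,\bar z))$, where $\alpha$ (possibly empty) and $\beta$ are finite conjunctions of relational atoms over variables and constants. For a finite set $\Sigma$ of tgds, a trigger on $I$ is a pair $(\xi,h)$ with $\xi=(\alpha\rightarrow\beta)\in\Sigma$ and $h$ an assignment of constants and nulls to the variables of $\alpha$ with $h(\alpha)\subseteq I$; it is active if no extension $h'$ of $h$ satisfies $h'(\beta)\subseteq I$. A step of the core chase is possible if there is an active trigger on the current instance $I$; it adds to $I$, in parallel for all active triggers $(\xi,h)$, the atoms $h'(\beta)$, where $h'$ extends $h$ by assigning fresh, pairwise distinct nulls to the existential variables (distinct also for distinct triggers), and then replaces the result by its core. For an instance $I$, let $\mathsf{CT}^{\mathsf{core}}_{I\forall}$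 be the class of all finite sets $\Sigma$ of tgds such that every core chase sequence with $\Sigma$ starting from $I$ (for all choices of fresh nulls and of the cores) is finite. Then for every instance $I$ the set $\mathsf{CT}^{\mathsf{core}}_{I\forall}$ is $\mathsf{RE}$-complete: it is recursively enumerable, and every recursively enumerable set of natural numbers is many-one reducible to it by a computable function. Likewise, with the instance as part of the input, the set of all pairs $(I,\Sigma)$ with $\Sigma\in\mathsf{CT}^{\mathsf{core}}_{I\forall}$ is $\mathsf{RE}$-complete. (Finite sets are presented to the machine as lists of their elements.) -/

import Mathlib

namespace CoreChase

/-! ### Values, terms, atoms, instances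

Constants, nulls, variables and relation names are each a copy of `ℕ`. -/

/-- The elements of instances: `Sum.inl c` is the constant `c`, `Sum.inr n` is the null `n`. -/
abbrev Value : Type := ℕ ⊕ ℕ

/-- The terms of dependencies: `Sum.inl c` is the constant `c`, `Sum.inr v` is the variable `v`. -/
abbrev Term : Type := ℕ ⊕ ℕ

/-- A relational atom `R(t₁,…,tₖ)` with `k ≥ 1`, stored as `(R, t₁, [t₂,…,tₖ])`. A relation symbol
is a name together with a positive arity, so for every arity `k ≥ 1` there are countably many
relation symbols, and equal names with different arities are different symbols. -/
abbrev Atom (T : Type) : Type := ℕ × T × List T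

/-- The argument sequence of an atom. -/
def Atom.args {T : Type} (a : Atom T) : List T := a.2.1 :: a.2.2

/-- Apply a map to all arguments of an atom. -/
def Atom.map {T U : Type} (f : T → U) (a : Atom T) : Atom U := (a.1, f a.2.1, a.2.2.map f)

/-- A relational instance: a finite set of atoms over constants and nulls. -/
abbrev Instance : Type := Finset (Atom Value)

/-! ### Homomorphisms and cores -/

/-- `h` is a homomorphism from `I` to `J`: it is the identity on constants and `h(I) ⊆ J`.
(Only the values of `h` on the elements of `I` matter.) -/
def IsHom (h : Value → Value) (I J : Instance) : Prop :=
  (∀ c : ℕ, h (Sum.inl c) = Sum.inl c) ∧ I.image (Atom.map h) ⊆ J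

/-- `C` is a core of `I`: a subset of `I` into which `I` has an endomorphism, such that no
endomorphism of `C` has an image strictly smaller than `C`. -/
def IsCore (C I : Instance) : Prop :=
  C ⊆ I ∧ (∃ h, IsHom h I C) ∧ ¬ ∃ g, IsHom g C C ∧ C.image (Atom.map g) ⊂ C

/-! ### Tuple generating dependencies -/

/-- The set of variables that occur in a conjunction of atoms. -/
def varsOf (L : List (Atom Term)) : Finset ℕ :=
  ((L.flatMap Atom.args).filterMap Sum.getRight?).toFinset

/-- A tuple generating dependency `body → ∃ z̄ head`, given by two finite conjunctions of atoms. The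
variables of the body are universally quantified, the remaining variables of the head
existentially. Constants may occur, and the body may be the empty conjunction. -/
abbrev TGD : Type := List (Atom Term) × List (Atom Term)

instance : DecidableEq TGD :=
  @instDecidableEqProd _ _ inferInstance inferInstance

/-- The body of a tgd. -/
def TGD.body (ξ : TGD) : List (Atom Term) := ξ.1

/-- The head of a tgd. -/
def TGD.head (ξ : TGD) : List (Atom Term) := ξ.2

/-- The existentially quantified variables of a tgd. -/
def TGD.exVars (ξ : TGD) : Finset ℕ := varsOf (TGD.head ξ) \ varsOf (TGD.body ξ)

/-- The value of a term under an assignment of values to the variables. -/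
def termVal (f : ℕ → Value) : Term → Value := Sum.elim Sum.inl f

/-- `f` maps every atom of the conjunction `L` into `I`. -/
def MapsInto (f : ℕ → Value) (L : List (Atom Term)) (I : Instance) : Prop :=
  ∀ a ∈ L, Atom.map (termVal f) a ∈ I

/-! ### Triggers -/

/-- A pair `(ξ, h)` of a tgd and an assignment of values to exactly the variables of its body. -/
abbrev PreTrigger : Type := (ξ : TGD) × (varsOf (TGD.body ξ) → Value)

/-- The extension of the assignment `h` of `(ξ, h)` that agrees with `g` on all variables which do
not occur in the body of `ξ`. Every extension of `h` has this form. -/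
def PreTrigger.extend (t : PreTrigger) (g : ℕ → Value) (v : ℕ) : Value :=
  if hv : v ∈ varsOf (TGD.body t.1) then t.2 ⟨v, hv⟩ else g v

/-- `(ξ, h)` is a trigger for `S` on `I`: `ξ ∈ S` and `h` maps the body of `ξ` into `I`. (The
assignment `g` is irrelevant: `h` is defined on all variables of the body.) -/
def IsTrigger (S : Finset TGD) (I : Instance) (t : PreTrigger) : Prop :=
  t.1 ∈ S ∧ ∀ g : ℕ → Value, MapsInto (PreTrigger.extend t g) (TGD.body t.1) I

/-- A trigger `(ξ, h)` is active if no extension of `h` maps the head of `ξ` into `I`. -/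
def IsActive (S : Finset TGD) (I : Instance) (t : PreTrigger) : Prop :=
  IsTrigger S I t ∧ ¬ ∃ g : ℕ → Value, MapsInto (PreTrigger.extend t g) (TGD.head t.1) I

/-! ### The core chase -/

/-- The choice of the null `ν t z` for the existential variable `z` of each active trigger `t` is
fresh: the nulls do not occur in `I`, and different pairs `(t, z)` receive different nulls. -/
def IsFresh (S : Finset TGD) (I : Instance) (ν : PreTrigger → ℕ → ℕ) : Prop :=
  (∀ t, IsActive S I t → ∀ z ∈ TGD.exVars t.1, ∀ a ∈ I, Sum.inr (ν t z) ∉ Atom.args a) ∧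
  ∀ t, IsActive S I t → ∀ z ∈ TGD.exVars t.1, ∀ t', IsActive S I t' → ∀ z' ∈ TGD.exVars t'.1,
    ν t z = ν t' z' → t = t' ∧ z = z'

/-- `K` is the result of firing in parallel all active triggers on `I`, with the fresh nulls `ν`:
the union of `I` with the images of the heads of all active triggers. -/
def IsParallelFiring (S : Finset TGD) (I : Instance) (ν : PreTrigger → ℕ → ℕ) (K : Instance) :
    Prop :=
  ∀ a, a ∈ K ↔ a ∈ I ∨ ∃ t, IsActive S I t ∧ ∃ b ∈ TGD.head t.1,
    a = Atom.map (termVal (PreTrigger.extend t fun z => Sum.inr (ν t z))) b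

/-- One step of the core chase: there is an active trigger on `I`, all active triggers on `I` are
fired in parallel with fresh nulls, and `J` is a core of the result. -/
def CoreStep (S : Finset TGD) (I J : Instance) : Prop :=
  (∃ t, IsActive S I t) ∧
  ∃ (ν : PreTrigger → ℕ → ℕ) (K : Instance),
    IsFresh S I ν ∧ IsParallelFiring S I ν K ∧ IsCore J K

/-- The core chase with `S` on `I` terminates on all branches, a branch being given by a choice of
the fresh nulls and of the core in every step: no core chase sequence from `I` is infinite. -/
def CoreChaseTerminates (S : Finset TGD) (I : Instance) : Prop :=
  ¬ ∃ s : ℕ → Instance, s 0 = I ∧ ∀ n, CoreStep S (s n) (s (n + 1))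

/-- The class of all finite sets of tgds with which the core chase on `I` terminates on all
branches. -/
def CTcore (I : Instance) : Set (Finset TGD) := {S | CoreChaseTerminates S I}

/-! ### Completeness for the recursively enumerable sets -/

/-- `p` is recursively enumerable, and every recursively enumerable set of natural numbers is
many-one reducible to `p` by a computable function. -/
def REComplete {α : Type} [Primcodable α] (p : α → Prop) : Prop :=
  REPred p ∧ ∀ q : ℕ → Prop, REPred q → q ≤₀ p

end CoreChase

/-!
The core chase with `Σ` from `I` terminates if and only if `I` has a finite universal model of `Σ`,
that is, a model `U` with homomorphisms `I → U → J` for some `J` obtained from `I` by firing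
triggers one at a time. For if `U` exists, the chase reaches a core that is homomorphically
equivalent to `U`; as endomorphisms of a core are invertible, this core is itself a model, and no
trigger on it is active. Such `U` and `J` with their homomorphisms are finite certificates, so the
sets in question are recursively enumerable.

For hardness, a partial recursive function is evaluated by rewriting binary trees at the root, and
trees are represented in instances by nodes with two children. The tgd of a rewriting rule adds a
copy of the right-hand side, linked by an edge to the root of the configuration it replaces. A
halting run gives a finite universal model. An infinite run yields paths of edges of every length.
A universal model would map all of them into a single derived instance, but there every edge leads
to a younger null, so that the lengths of paths are bounded.
-/

namespace CoreChase

/-! ### Homomorphisms and models -/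

section Homomorphisms

variable {S : Finset TGD} {I J K U : Instance} {L : List (Atom Term)} {ξ : TGD}
  {f g φ ψ : ℕ → Value}

theorem Atom.map_map {T U V : Type} (g : U → V) (f : T → U) (a : Atom T) :
    Atom.map g (Atom.map f a) = Atom.map (g ∘ f) a := by
  simp [Atom.map]

theorem Atom.map_id {T : Type} (a : Atom T) : Atom.map id a = a := by
  simp [Atom.map]

theorem Atom.args_map {T U : Type} (f : T → U) (a : Atom T) :
    Atom.args (Atom.map f a) = (Atom.args a).map f := by
  simp [Atom.map, Atom.args]

theorem Atom.map_eq_map_iff {T U : Type} {f g : T → U} {a : Atom T} :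
    Atom.map f a = Atom.map g a ↔ ∀ x ∈ Atom.args a, f x = g x := by
  simp [Atom.map, Atom.args]

/-- The active domain of a finite set of atoms: the elements that occur in it. -/
def adom {T : Type} [DecidableEq T] (A : Finset (Atom T)) : Finset T :=
  A.biUnion fun a => (Atom.args a).toFinset

theorem mem_adom {T : Type} [DecidableEq T] {A : Finset (Atom T)} {x : T} :
    x ∈ adom A ↔ ∃ a ∈ A, x ∈ Atom.args a := by
  simp [adom]

theorem termVal_comp (g f : ℕ → Value) : termVal g ∘ termVal f = termVal (termVal g ∘ f) := by
  funext x
  rcases x with c | v <;> rfl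

theorem termVal_inr : termVal Sum.inr = id := by
  funext x
  rcases x with c | v <;> rfl

theorem mem_varsOf {v : ℕ} : v ∈ varsOf L ↔ ∃ a ∈ L, Sum.inr v ∈ Atom.args a := by
  simp [varsOf]

theorem MapsInto.congr (hf : MapsInto f L I) (h : ∀ v ∈ varsOf L, f v = g v) :
    MapsInto g L I := by
  intro a ha
  rw [← Atom.map_eq_map_iff.2 fun x hx => ?_]
  · exact hf a ha
  · rcases x with c | v
    · rfl
    · exact h v (mem_varsOf.2 ⟨a, ha, hx⟩)

theorem MapsInto.mono (hf : MapsInto f L I) (h : I ⊆ J) : MapsInto f L J := fun a ha => h (hf a ha)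

theorem MapsInto.mem_adom (hf : MapsInto f L I) {v : ℕ} (hv : v ∈ varsOf L) : f v ∈ adom I := by
  obtain ⟨a, ha, hva⟩ := mem_varsOf.1 hv
  refine CoreChase.mem_adom.2 ⟨_, hf a ha, ?_⟩
  rw [Atom.args_map]
  exact List.mem_map_of_mem (f := termVal f) hva

/-- `φ`, extended by the identity on constants, is a homomorphism from `I` to `J`. -/
def Sends (φ : ℕ → Value) (I J : Instance) : Prop := ∀ a ∈ I, Atom.map (termVal φ) a ∈ J

/-- There is a homomorphism from `I` to `J`. -/
def HomTo (I J : Instance) : Prop := ∃ φ, Sends φ I J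

theorem Sends.mono_right (hφ : Sends φ I J) (h : J ⊆ K) : Sends φ I K := fun a ha => h (hφ a ha)

theorem Sends.congr (hφ : Sends φ I J) (h : ∀ x ∈ adom I, termVal φ x = termVal ψ x) :
    Sends ψ I J := fun a ha => by
  rw [← Atom.map_eq_map_iff.2 fun x hx => h x (mem_adom.2 ⟨a, ha, hx⟩)]
  exact hφ a ha

theorem Sends.mapsInto (hφ : Sends φ I J) (hf : MapsInto f L I) :
    MapsInto (termVal φ ∘ f) L J := fun a ha => by
  rw [← termVal_comp, ← Atom.map_map]
  exact hφ _ (hf a ha)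

theorem Sends.comp (hψ : Sends ψ J K) (hφ : Sends φ I J) : Sends (termVal ψ ∘ φ) I K :=
  fun a ha => by
    rw [← termVal_comp, ← Atom.map_map]
    exact hψ _ (hφ a ha)

theorem Sends.inr_of_subset (h : I ⊆ J) : Sends Sum.inr I J := fun a ha => by
  rw [termVal_inr, Atom.map_id]
  exact h ha

theorem HomTo.trans : HomTo I J → HomTo J K → HomTo I K :=
  fun ⟨_, hφ⟩ ⟨_, hψ⟩ => ⟨_, hψ.comp hφ⟩

theorem HomTo.of_subset (h : I ⊆ J) : HomTo I J := ⟨_, Sends.inr_of_subset h⟩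

theorem HomTo.refl (I : Instance) : HomTo I I := HomTo.of_subset subset_rfl

theorem IsHom.eq_termVal {h : Value → Value} (hh : IsHom h I J) : h = termVal (h ∘ Sum.inr) := by
  funext x
  rcases x with c | n
  · exact hh.1 c
  · rfl

theorem IsHom.sends {h : Value → Value} (hh : IsHom h I J) : Sends (h ∘ Sum.inr) I J :=
  fun a ha => by
    rw [← hh.eq_termVal]
    exact hh.2 (Finset.mem_image_of_mem _ ha)

theorem Sends.isHom (h : Sends φ I J) : IsHom (termVal φ) I J :=
  ⟨fun _ => rfl, Finset.image_subset_iff.2 h⟩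

/-- The values which `f` gives to the body variables of `ξ` can be completed to an assignment that
maps the head of `ξ` into `U`. -/
def HasExtension (ξ : TGD) (f : ℕ → Value) (U : Instance) : Prop :=
  ∃ g, (∀ v ∈ varsOf (TGD.body ξ), g v = f v) ∧ MapsInto g (TGD.head ξ) U

/-- All tgds of `S` hold in `U`. -/
def Model (S : Finset TGD) (U : Instance) : Prop :=
  ∀ ξ ∈ S, ∀ f, MapsInto f (TGD.body ξ) U → HasExtension ξ f U

theorem HasExtension.mono (h : HasExtension ξ f I) (hIJ : I ⊆ J) : HasExtension ξ f J :=
  let ⟨g, hg, hgI⟩ := h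
  ⟨g, hg, hgI.mono hIJ⟩

theorem HasExtension.map (h : HasExtension ξ f I) (hφ : Sends φ I J) :
    HasExtension ξ (termVal φ ∘ f) J :=
  let ⟨_, hg, hgI⟩ := h
  ⟨_, fun v hv => congrArg (termVal φ) (hg v hv), hφ.mapsInto hgI⟩

theorem HasExtension.congr (h : HasExtension ξ f I)
    (hfg : ∀ v ∈ varsOf (TGD.body ξ), f v = g v) : HasExtension ξ g I :=
  let ⟨e, he, heI⟩ := h
  ⟨e, fun v hv => (he v hv).trans (hfg v hv), heI⟩

/-- The trigger candidate given by a total assignment. -/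
def PreTrigger.ofFun (ξ : TGD) (f : ℕ → Value) : PreTrigger := ⟨ξ, fun v => f v⟩

/-- A total assignment with the values of `t` on the body variables; elsewhere it is the constant
`0`, a junk value. -/
def PreTrigger.assign (t : PreTrigger) : ℕ → Value := PreTrigger.extend t fun _ => Sum.inl 0

theorem PreTrigger.extend_of_mem {t : PreTrigger} {v : ℕ} (hv : v ∈ varsOf (TGD.body t.1)) :
    PreTrigger.extend t g v = PreTrigger.assign t v := by
  simp [PreTrigger.assign, PreTrigger.extend, hv]

theorem PreTrigger.extend_of_notMem {t : PreTrigger} {v : ℕ} (hv : v ∉ varsOf (TGD.body t.1)) :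
    PreTrigger.extend t g v = g v := by
  simp [PreTrigger.extend, hv]

theorem PreTrigger.assign_ofFun {v : ℕ} (hv : v ∈ varsOf (TGD.body ξ)) :
    PreTrigger.assign (PreTrigger.ofFun ξ f) v = f v := by
  simp [PreTrigger.assign, PreTrigger.extend, PreTrigger.ofFun, hv]

theorem isActive_iff {t : PreTrigger} :
    IsActive S I t ↔ t.1 ∈ S ∧ MapsInto (PreTrigger.assign t) (TGD.body t.1) I ∧
      ¬ HasExtension t.1 (PreTrigger.assign t) I := by
  have body_iff : (∀ g, MapsInto (PreTrigger.extend t g) (TGD.body t.1) I) ↔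
      MapsInto (PreTrigger.assign t) (TGD.body t.1) I :=
    ⟨fun h => h _, fun h g => h.congr fun _ hv => (PreTrigger.extend_of_mem hv).symm⟩
  have head_iff : (∃ g, MapsInto (PreTrigger.extend t g) (TGD.head t.1) I) ↔
      HasExtension t.1 (PreTrigger.assign t) I := by
    refine ⟨fun ⟨g, hg⟩ => ⟨_, fun _ hv => PreTrigger.extend_of_mem hv, hg⟩,
      fun ⟨g, hg, hgI⟩ => ⟨g, hgI.congr fun v _ => ?_⟩⟩
    by_cases hv : v ∈ varsOf (TGD.body t.1)
    · rw [hg v hv, PreTrigger.extend_of_mem hv]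
    · rw [PreTrigger.extend_of_notMem hv]
  rw [IsActive, IsTrigger, body_iff, head_iff, and_assoc]

theorem isActive_ofFun (hξ : ξ ∈ S) (hf : MapsInto f (TGD.body ξ) I) (h : ¬ HasExtension ξ f I) :
    IsActive S I (PreTrigger.ofFun ξ f) :=
  isActive_iff.2 ⟨hξ, hf.congr fun _ hv => (PreTrigger.assign_ofFun hv).symm,
    fun he => h (he.congr fun _ hv => PreTrigger.assign_ofFun hv)⟩

theorem model_iff_forall_not_isActive : Model S I ↔ ∀ t, ¬ IsActive S I t := by
  refine ⟨fun h t ht => ?_, fun h ξ hξ f hf => by_contra fun hn => h _ (isActive_ofFun hξ hf hn)⟩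
  obtain ⟨hS, hbody, hhead⟩ := isActive_iff.1 ht
  exact hhead (h _ hS _ hbody)

end Homomorphisms

/-! ### Derivations -/

section Derivations

variable {S : Finset TGD} {I J M U : Instance} {ξ : TGD} {f φ ψ : ℕ → Value} {N : ℕ}

/-- The rank of a value or term: `0` for constants and `n + 1` for the null or variable `n`. -/
def rank : ℕ ⊕ ℕ → ℕ := Sum.elim (fun _ => 0) Nat.succ

/-- All nulls, or variables, that occur in `A` are smaller than `k`. -/
def IndicesBelow (k : ℕ) (A : Finset (Atom (ℕ ⊕ ℕ))) : Prop := ∀ x ∈ adom A, rank x ≤ k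

theorem exists_indicesBelow (A : Finset (Atom (ℕ ⊕ ℕ))) : ∃ k, IndicesBelow k A := by
  obtain ⟨k, hk⟩ := ((adom A).image rank).exists_le
  exact ⟨k, fun x hx => hk _ (Finset.mem_image_of_mem _ hx)⟩

theorem IndicesBelow.mono {k m : ℕ} {A : Finset (Atom (ℕ ⊕ ℕ))} (h : IndicesBelow k A)
    (hkm : k ≤ m) : IndicesBelow m A := fun x hx => (h x hx).trans hkm

/-- The assignment that agrees with `f` on the body of `ξ` and gives the null `N + v` to every other
variable `v`. -/
def freshExt (ξ : TGD) (f : ℕ → Value) (N : ℕ) (v : ℕ) : Value :=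
  if v ∈ varsOf (TGD.body ξ) then f v else Sum.inr (N + v)

/-- The atoms added when the trigger `(ξ, f)` is fired with nulls from `N` on. -/
def fired (ξ : TGD) (f : ℕ → Value) (N : ℕ) : Instance :=
  ((TGD.head ξ).map (Atom.map (termVal (freshExt ξ f N)))).toFinset

theorem mem_fired {a : Atom Value} :
    a ∈ fired ξ f N ↔ ∃ b ∈ TGD.head ξ, Atom.map (termVal (freshExt ξ f N)) b = a := by
  simp [fired]

/-- The instances obtained from `I` by firing triggers of `S`, active or not, one at a time. -/
inductive Deriv (S : Finset TGD) (I : Instance) : Instance → Prop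
  | refl : Deriv S I I
  | step {J : Instance} (ξ : TGD) (f : ℕ → Value) (N : ℕ) (hJ : Deriv S I J) (hξ : ξ ∈ S)
      (hf : MapsInto f (TGD.body ξ) J) (hN : IndicesBelow N J) : Deriv S I (J ∪ fired ξ f N)

theorem freshExt_of_mem {v : ℕ} (hv : v ∈ varsOf (TGD.body ξ)) : freshExt ξ f N v = f v :=
  if_pos hv

theorem freshExt_of_notMem {v : ℕ} (hv : v ∉ varsOf (TGD.body ξ)) :
    freshExt ξ f N v = Sum.inr (N + v) :=
  if_neg hv

theorem Deriv.subset (h : Deriv S I J) : I ⊆ J := by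
  induction h with
  | refl => exact subset_rfl
  | step ξ f N _ _ _ _ ih => exact ih.trans Finset.subset_union_left

theorem mapsInto_head_of_agree {e : ℕ → Value} (hbody : MapsInto f (TGD.body ξ) I)
    (hagree : ∀ x ∈ adom I, termVal φ x = termVal ψ x)
    (hg : ∀ v ∈ varsOf (TGD.body ξ), e v = termVal φ (f v))
    (hfresh : ∀ v ∈ TGD.exVars ξ, e v = termVal ψ (f v)) (he : MapsInto e (TGD.head ξ) M) :
    MapsInto (termVal ψ ∘ f) (TGD.head ξ) M := by
  refine he.congr fun v hv => ?_
  by_cases hvb : v ∈ varsOf (TGD.body ξ)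
  · exact (hg v hvb).trans (hagree _ (hbody.mem_adom hvb))
  · exact hfresh v (Finset.mem_sdiff.2 ⟨hv, hvb⟩)

theorem homTo_union_fired (hφ : Sends φ J M) (hf : MapsInto f (TGD.body ξ) J)
    (hN : IndicesBelow N J) (hM : HasExtension ξ (termVal φ ∘ f) M) :
    HomTo (J ∪ fired ξ f N) M := by
  obtain ⟨e, he, heM⟩ := hM
  let ψ : ℕ → Value := fun n => if n < N then φ n else e (n - N)
  have hagree : ∀ x ∈ adom J, termVal φ x = termVal ψ x := by
    rintro (c | n) hx
    · rfl
    · exact (if_pos (hN _ hx)).symm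
  have hbody : MapsInto (freshExt ξ f N) (TGD.body ξ) J :=
    hf.congr fun v hv => (freshExt_of_mem hv).symm
  have hhead : MapsInto (termVal ψ ∘ freshExt ξ f N) (TGD.head ξ) M := by
    refine mapsInto_head_of_agree hbody hagree (fun v hv => ?_) (fun v hv => ?_) heM
    · rw [he v hv, freshExt_of_mem hv, Function.comp_apply]
    · rw [freshExt_of_notMem (Finset.mem_sdiff.1 hv).2]
      simp [ψ, termVal]
  refine ⟨ψ, fun a ha => ?_⟩
  rcases Finset.mem_union.1 ha with ha | ha
  · exact hφ.congr hagree a ha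
  · obtain ⟨b, hb, rfl⟩ := mem_fired.1 ha
    rw [Atom.map_map, termVal_comp]
    exact hhead b hb

theorem Deriv.homTo_model (h : Deriv S I J) (hI : HomTo I U) (hU : Model S U) : HomTo J U := by
  induction h with
  | refl => exact hI
  | step ξ f N _ hξ hf hN ih =>
    obtain ⟨φ, hφ⟩ := ih
    exact homTo_union_fired hφ hf hN (hU ξ hξ _ (hφ.mapsInto hf))

theorem hasExtension_fired : HasExtension ξ f (fired ξ f N) :=
  ⟨freshExt ξ f N, fun _ hv => freshExt_of_mem hv, fun a ha => mem_fired.2 ⟨a, ha, rfl⟩⟩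

theorem Deriv.exists_forall_hasExtension (h : Deriv S I J) (T : List (TGD × (ℕ → Value)))
    (hT : ∀ t ∈ T, t.1 ∈ S ∧ MapsInto t.2 (TGD.body t.1) J) :
    ∃ J', Deriv S I J' ∧ J ⊆ J' ∧ ∀ t ∈ T, HasExtension t.1 t.2 J' := by
  induction T with
  | nil => exact ⟨J, h, subset_rfl, by simp⟩
  | cons t T ih =>
    obtain ⟨J', hd, hs, hJ'⟩ := ih fun t ht => hT t (List.mem_cons_of_mem _ ht)
    obtain ⟨hξ, hf⟩ := hT t List.mem_cons_self
    obtain ⟨N, hN⟩ := exists_indicesBelow J'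
    refine ⟨J' ∪ fired t.1 t.2 N, hd.step t.1 t.2 N hξ (hf.mono hs) hN,
      hs.trans Finset.subset_union_left, List.forall_mem_cons.2 ⟨?_, fun t' ht' => ?_⟩⟩
    · exact hasExtension_fired.mono Finset.subset_union_right
    · exact (hJ' t' ht').mono Finset.subset_union_left

end Derivations

/-! ### Steps of the core chase -/

section CoreSteps

variable {S : Finset TGD} {I J K M U C : Instance} {ν : PreTrigger → ℕ → ℕ} {θ φ : ℕ → Value}

theorem finite_isActive (S : Finset TGD) (I : Instance) : {t | IsActive S I t}.Finite := by
  have hfin : (⋃ ξ ∈ S, (fun h => (⟨ξ, h⟩ : PreTrigger)) ''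
      (Set.univ.pi fun _ : varsOf (TGD.body ξ) => (adom I : Set Value))).Finite :=
    S.finite_toSet.biUnion fun ξ _ => (Set.Finite.pi fun _ => (adom I).finite_toSet).image _
  refine hfin.subset fun t ht => ?_
  obtain ⟨hS, hbody, -⟩ := isActive_iff.1 ht
  refine Set.mem_biUnion hS ⟨t.2, fun v _ => ?_, rfl⟩
  have := hbody.mem_adom v.2
  rwa [PreTrigger.assign, PreTrigger.extend, dif_pos v.2] at this

theorem exists_isFresh (S : Finset TGD) (I : Instance) : ∃ ν, IsFresh S I ν := by
  obtain ⟨N, hN⟩ := exists_indicesBelow I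
  obtain ⟨e, he⟩ := exists_injective_nat PreTrigger
  refine ⟨fun t z => N + Nat.pair (e t) z, fun t _ z _ a ha hn => ?_, fun t _ z _ t' _ z' _ h => ?_⟩
  · exact absurd (hN _ (mem_adom.2 ⟨a, ha, hn⟩)) (Nat.not_le.2 (Nat.lt_succ_of_le le_self_add))
  · obtain ⟨het, hz⟩ := Nat.pair_eq_pair.1 (Nat.add_left_cancel h)
    exact ⟨he het, hz⟩

theorem exists_isParallelFiring (S : Finset TGD) (I : Instance) (ν : PreTrigger → ℕ → ℕ) :
    ∃ K, IsParallelFiring S I ν K := by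
  classical
  refine ⟨I ∪ (finite_isActive S I).toFinset.biUnion fun t => ((TGD.head t.1).map
    (Atom.map (termVal (PreTrigger.extend t fun z => Sum.inr (ν t z))))).toFinset, fun a => ?_⟩
  simp [eq_comm]

theorem exists_isCore (I : Instance) : ∃ C, IsCore C I := by
  classical
  have hne : (I.powerset.filter fun C => HomTo I C).Nonempty := ⟨I, by simp [HomTo.refl]⟩
  obtain ⟨C, hC, hmin⟩ := Finset.exists_min_image _ Finset.card hne
  simp only [Finset.mem_filter, Finset.mem_powerset] at hC hmin
  obtain ⟨hCI, φ, hφ⟩ := hC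
  refine ⟨C, hCI, ⟨_, hφ.isHom⟩, ?_⟩
  rintro ⟨g, hg, hlt⟩
  have hgC : Sends (g ∘ Sum.inr) C (C.image (Atom.map g)) :=
    IsHom.sends ⟨hg.1, subset_rfl⟩
  exact (hmin _ ⟨hlt.1.trans hCI, _, hgC.comp hφ⟩).not_gt (Finset.card_lt_card hlt)

theorem exists_coreStep (h : ∃ t, IsActive S I t) : ∃ J, CoreStep S I J := by
  obtain ⟨ν, hν⟩ := exists_isFresh S I
  obtain ⟨K, hK⟩ := exists_isParallelFiring S I ν
  obtain ⟨C, hC⟩ := exists_isCore K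
  exact ⟨C, h, ν, K, hν, hK, hC⟩

theorem IsParallelFiring.subset (hK : IsParallelFiring S I ν K) : I ⊆ K :=
  fun a ha => (hK a).2 (Or.inl ha)

theorem IsParallelFiring.hasExtension (hK : IsParallelFiring S I ν K) {ξ : TGD} {f : ℕ → Value}
    (hξ : ξ ∈ S) (hf : MapsInto f (TGD.body ξ) I) : HasExtension ξ f K := by
  by_cases h : HasExtension ξ f I
  · exact h.mono hK.subset
  · refine ⟨PreTrigger.extend (PreTrigger.ofFun ξ f) fun z =>
      Sum.inr (ν (PreTrigger.ofFun ξ f) z), fun v hv => ?_, fun b hb =>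
      (hK _).2 (Or.inr ⟨_, isActive_ofFun hξ hf h, b, hb, rfl⟩)⟩
    exact (PreTrigger.extend_of_mem hv).trans (PreTrigger.assign_ofFun hv)

/-- The pairs of an active trigger and one of its existential variables, for which the core chase
needs fresh nulls. -/
def FreshIndex (S : Finset TGD) (I : Instance) : Type :=
  {p : PreTrigger × ℕ // IsActive S I p.1 ∧ p.2 ∈ TGD.exVars p.1.1}

theorem IsFresh.injective (hν : IsFresh S I ν) :
    Function.Injective fun p : FreshIndex S I => ν p.1.1 p.1.2 :=
  fun p q h => Subtype.ext (Prod.ext_iff.2 (hν.2 _ p.2.1 _ p.2.2 _ q.2.1 _ q.2.2 h))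

theorem homTo_parallelFiring (hν : IsFresh S I ν) (hK : IsParallelFiring S I ν K)
    (hφ : Sends φ I M)
    (hM : ∀ t, IsActive S I t → HasExtension t.1 (termVal φ ∘ PreTrigger.assign t) M) :
    HomTo K M := by
  choose! e he heM using hM
  let ψ : ℕ → Value := Function.extend (fun p : FreshIndex S I => ν p.1.1 p.1.2)
    (fun p => e p.1.1 p.1.2) φ
  have hψ_fresh : ∀ t, IsActive S I t → ∀ z ∈ TGD.exVars t.1, ψ (ν t z) = e t z :=
    fun t ht z hz => hν.injective.extend_apply _ _ ⟨(t, z), ht, hz⟩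
  have hagree : ∀ x ∈ adom I, termVal φ x = termVal ψ x := by
    rintro (c | n) hx
    · rfl
    · change φ n = ψ n
      refine (Function.extend_apply' _ φ n ?_).symm
      rintro ⟨p, rfl⟩
      obtain ⟨a, ha, hna⟩ := mem_adom.1 hx
      exact hν.1 _ p.2.1 _ p.2.2 a ha hna
  refine ⟨ψ, fun a ha => ?_⟩
  rcases (hK a).1 ha with ha | ⟨t, ht, b, hb, rfl⟩
  · exact hφ.congr hagree a ha
  · rw [Atom.map_map, termVal_comp]
    refine mapsInto_head_of_agree (ht.1.2 _) hagree (fun v hv => ?_) (fun v hv => ?_)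
      (heM t ht) b hb
    · rw [he t ht v hv, PreTrigger.extend_of_mem hv, Function.comp_apply]
    · rw [PreTrigger.extend_of_notMem (Finset.mem_sdiff.1 hv).2]
      exact (hψ_fresh t ht v hv).symm

theorem IsCore.homTo (h : IsCore C I) : HomTo I C :=
  let ⟨_, hh⟩ := h.2.1
  ⟨_, hh.sends⟩

theorem CoreStep.homTo (h : CoreStep S I J) : HomTo I J := by
  obtain ⟨-, ν, K, -, hK, hC⟩ := h
  exact (HomTo.of_subset hK.subset).trans hC.homTo

theorem CoreStep.homTo_model (h : CoreStep S I J) (hI : HomTo I U) (hU : Model S U) :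
    HomTo J U := by
  obtain ⟨-, ν, K, hν, hK, hC⟩ := h
  obtain ⟨φ, hφ⟩ := hI
  refine (HomTo.of_subset hC.1).trans (homTo_parallelFiring hν hK hφ fun t ht => ?_)
  obtain ⟨hξ, hbody, -⟩ := isActive_iff.1 ht
  exact hU t.1 hξ _ (hφ.mapsInto hbody)

theorem CoreStep.exists_deriv {D : Instance} (h : CoreStep S J K) (hD : Deriv S I D)
    (hJ : HomTo J D) : ∃ D', Deriv S I D' ∧ HomTo K D' := by
  obtain ⟨-, ν, K', hν, hK', hC⟩ := h
  obtain ⟨φ, hφ⟩ := hJ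
  obtain ⟨D', hD', hsub, hext⟩ := hD.exists_forall_hasExtension
    ((finite_isActive S J).toFinset.toList.map fun t => (t.1, termVal φ ∘ PreTrigger.assign t)) (by
      intro p hp
      obtain ⟨t, ht, rfl⟩ := List.mem_map.1 hp
      obtain ⟨hξ, hbody, -⟩ := isActive_iff.1 (by simpa using ht : IsActive S J t)
      exact ⟨hξ, hφ.mapsInto hbody⟩)
  exact ⟨D', hD', (HomTo.of_subset hC.1).trans (homTo_parallelFiring hν hK' (hφ.mono_right hsub)
    fun t ht => hext _ (List.mem_map.2 ⟨t, by simpa using ht, rfl⟩))⟩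

theorem Deriv.exists_homTo (h : Deriv S I J) {s : ℕ → Instance} (h0 : s 0 = I)
    (hs : ∀ n, CoreStep S (s n) (s (n + 1))) : ∃ m, HomTo J (s m) := by
  induction h with
  | refl => exact ⟨0, h0 ▸ HomTo.refl _⟩
  | step ξ f N _ hξ hf hN ih =>
    obtain ⟨m, φ, hφ⟩ := ih
    obtain ⟨-, ν, K, -, hK, hC⟩ := hs m
    exact ⟨m + 1, (homTo_union_fired (hφ.mono_right hK.subset) hf hN
      (hK.hasExtension hξ (hφ.mapsInto hf))).trans hC.homTo⟩

theorem IsCore.image_map_eq (hC : IsCore C K) (hθ : Sends θ C C) :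
    C.image (Atom.map (termVal θ)) = C :=
  by_contra fun hne => hC.2.2 ⟨_, hθ.isHom, lt_of_le_of_ne hθ.isHom.2 hne⟩

theorem exists_iterate_succ_eq_id {α : Type*} [Finite α] {F : α → α}
    (hF : Function.Surjective F) : ∃ k, F^[k + 1] = id := by
  let σ : Equiv.Perm α := Equiv.ofBijective F (Finite.surjective_iff_bijective.1 hF)
  refine ⟨orderOf σ - 1, ?_⟩
  rw [Nat.sub_add_cancel (orderOf_pos σ), ← Equiv.Perm.coe_one, ← pow_orderOf_eq_one σ]
  exact Equiv.Perm.iterate_eq_pow σ _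

theorem Sends.exists_iterate (hθ : Sends θ C C) (k : ℕ) :
    ∃ χ, Sends χ C C ∧ termVal χ = (termVal θ)^[k] := by
  induction k with
  | zero => exact ⟨_, Sends.inr_of_subset subset_rfl, termVal_inr⟩
  | succ k ih =>
    obtain ⟨χ, hχ, hiter⟩ := ih
    exact ⟨_, hχ.comp hθ, by rw [← termVal_comp, hiter, Function.iterate_succ]⟩

theorem IsCore.exists_leftInverse (hC : IsCore C K) (hθ : Sends θ C C) :
    ∃ χ, Sends χ C C ∧ ∀ x ∈ adom C, termVal χ (termVal θ x) = x := by
  let F : C → C := fun a => ⟨Atom.map (termVal θ) a, hθ a a.2⟩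
  have hsurj : Function.Surjective F := by
    rintro ⟨b, hb⟩
    rw [← hC.image_map_eq hθ] at hb
    obtain ⟨a, ha, rfl⟩ := Finset.mem_image.1 hb
    exact ⟨⟨a, ha⟩, rfl⟩
  have coe_iterate : ∀ n a, (F^[n] a : Atom Value) = Atom.map ((termVal θ)^[n]) a := by
    intro n
    induction n with
    | zero => exact fun a => (Atom.map_id _).symm
    | succ n ih =>
      intro a
      rw [Function.iterate_succ_apply, ih, Function.iterate_succ, ← Atom.map_map]
  obtain ⟨k, hk⟩ := exists_iterate_succ_eq_id hsurj
  obtain ⟨χ, hχ, hiter⟩ := hθ.exists_iterate k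
  refine ⟨χ, hχ, fun x hx => ?_⟩
  obtain ⟨a, ha, hxa⟩ := mem_adom.1 hx
  have hfix : Atom.map id a = Atom.map ((termVal θ)^[k + 1]) a := by
    rw [← coe_iterate (k + 1) ⟨a, ha⟩, hk, Atom.map_id, id]
  rw [hiter, ← Function.iterate_succ_apply]
  exact (Atom.map_eq_map_iff.1 hfix x hxa).symm

theorem IsCore.model (hC : IsCore C K) (hU : Model S U) (hCU : HomTo C U) (hUC : HomTo U C) :
    Model S C := by
  obtain ⟨φ, hφ⟩ := hCU
  obtain ⟨ψ, hψ⟩ := hUC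
  obtain ⟨χ, hχ, hinv⟩ := hC.exists_leftInverse (hψ.comp hφ)
  intro ξ hξ f hf
  refine (((hU ξ hξ _ (hφ.mapsInto hf)).map hψ).map hχ).congr fun v hv => ?_
  have := hinv _ (hf.mem_adom hv)
  rwa [← termVal_comp] at this

theorem exists_universal_model_of_coreChaseTerminates (h : CoreChaseTerminates S I) :
    ∃ J U, Deriv S I J ∧ HomTo U J ∧ HomTo I U ∧ Model S U := by
  by_contra hno
  let P : Instance → Prop := fun A => HomTo I A ∧ ∃ D, Deriv S I D ∧ HomTo A D
  have hstep : ∀ A : {A // P A}, ∃ B : {B // P B}, CoreStep S A B := by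
    rintro ⟨A, hIA, D, hD, hAD⟩
    have hactive : ∃ t, IsActive S A t := by
      by_contra hna
      exact hno ⟨D, A, hD, hAD, hIA, model_iff_forall_not_isActive.2 (not_exists.1 hna)⟩
    obtain ⟨B, hB⟩ := exists_coreStep hactive
    exact ⟨⟨B, hIA.trans hB.homTo, hB.exists_deriv hD hAD⟩, hB⟩
  choose next hnext using hstep
  let s : ℕ → {A // P A} := fun n => next^[n] ⟨I, HomTo.refl I, I, Deriv.refl, HomTo.refl I⟩
  refine h ⟨fun n => s n, rfl, fun n => ?_⟩
  have hs_succ : s (n + 1) = next (s n) := Function.iterate_succ_apply' _ _ _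
  simpa only [hs_succ] using hnext (s n)

theorem coreChaseTerminates_of_universal_model (hJ : Deriv S I J) (hUJ : HomTo U J)
    (hIU : HomTo I U) (hU : Model S U) : CoreChaseTerminates S I := by
  rintro ⟨s, h0, hs⟩
  obtain ⟨m, hJs⟩ := hJ.exists_homTo h0 hs
  have hsU : ∀ n, HomTo (s n) U := by
    intro n
    induction n with
    | zero => rwa [h0]
    | succ n ih => exact (hs n).homTo_model ih hU
  obtain ⟨-, ν, K, -, -, hC⟩ := hs m
  have hmodel : Model S (s (m + 1)) :=
    hC.model hU (hsU _) ((hUJ.trans hJs).trans (hs m).homTo)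
  obtain ⟨t, ht⟩ := (hs (m + 1)).1
  exact model_iff_forall_not_isActive.1 hmodel t ht

theorem coreChaseTerminates_iff :
    CoreChaseTerminates S I ↔ ∃ J U, Deriv S I J ∧ HomTo U J ∧ HomTo I U ∧ Model S U :=
  ⟨exists_universal_model_of_coreChaseTerminates,
    fun ⟨_, _, hJ, hUJ, hIU, hU⟩ => coreChaseTerminates_of_universal_model hJ hUJ hIU hU⟩

end CoreSteps

/-! ### Certificates for termination -/

section Certificates

variable {S : List TGD} {I U : List (Atom Value)} {L : List (Atom Term)} {f g : ℕ → Value}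
  {l : List Value} {k N : ℕ}

/-- The assignment given by a list of values; beyond the end of the list it is the constant `0`. -/
def listVal (l : List Value) (n : ℕ) : Value := l.getD n (Sum.inl 0)

theorem listVal_map_range {n : ℕ} (hn : n < k) : listVal ((List.range k).map f) n = f n := by
  simp [listVal, hn]

theorem IndicesBelow.lt_of_mem_varsOf (h : IndicesBelow k L.toFinset) {v : ℕ} (hv : v ∈ varsOf L) :
    v < k := by
  obtain ⟨a, ha, hva⟩ := mem_varsOf.1 hv
  exact h _ (mem_adom.2 ⟨a, List.mem_toFinset.2 ha, hva⟩)

theorem IndicesBelow.subset {A B : Finset (Atom (ℕ ⊕ ℕ))} (h : IndicesBelow k B) (hAB : A ⊆ B) :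
    IndicesBelow k A := fun x hx =>
  let ⟨a, ha, hxa⟩ := mem_adom.1 hx
  h x (mem_adom.2 ⟨a, hAB ha, hxa⟩)

theorem mapsInto_append {L L' : List (Atom Term)} {J : Instance} :
    MapsInto f (L ++ L') J ↔ MapsInto f L J ∧ MapsInto f L' J := by
  simp only [MapsInto, List.forall_mem_append]

theorem HomTo.exists_sends_listVal {J K : Instance} (h : HomTo J K) :
    ∃ l, Sends (listVal l) J K := by
  obtain ⟨φ, hφ⟩ := h
  obtain ⟨N, hN⟩ := exists_indicesBelow J
  refine ⟨(List.range N).map φ, hφ.congr ?_⟩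
  rintro (c | n) hx
  · rfl
  · exact (listVal_map_range (hN _ hx)).symm

/-- All tuples of length `k` over `L`. -/
def tuples (L : List Value) : ℕ → List (List Value)
  | 0 => [[]]
  | k + 1 => (tuples L k).flatMap fun l => L.map fun x => x :: l

theorem mem_tuples {L : List Value} : l ∈ tuples L k ↔ l.length = k ∧ ∀ x ∈ l, x ∈ L := by
  induction k generalizing l with
  | zero => simp +contextual [tuples, List.length_eq_zero_iff]
  | succ k ih => rcases l with _ | ⟨x, l⟩ <;> simp [tuples, ih, and_assoc, and_left_comm]

/-- The elements of `U`, and one constant. -/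
def candidates (U : List (Atom Value)) : List Value := Sum.inl 0 :: U.flatMap Atom.args

theorem mem_candidates {x : Value} (hx : x ∈ adom U.toFinset) : x ∈ candidates U := by
  obtain ⟨a, ha, hxa⟩ := mem_adom.1 hx
  exact List.mem_cons_of_mem _ (List.mem_flatMap.2 ⟨a, List.mem_toFinset.1 ha, hxa⟩)

open Classical in
theorem exists_mem_tuples_listVal_eq (hf : MapsInto f L U.toFinset)
    (hk : IndicesBelow k L.toFinset) :
    ∃ l ∈ tuples (candidates U) k, ∀ v ∈ varsOf L, listVal l v = f v := by
  let f' : ℕ → Value := fun n => if f n ∈ candidates U then f n else Sum.inl 0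
  refine ⟨(List.range k).map f', mem_tuples.2 ⟨by simp, fun x hx => ?_⟩, fun v hv => ?_⟩
  · obtain ⟨n, -, rfl⟩ := List.mem_map.1 hx
    by_cases hn : f n ∈ candidates U
    · rwa [show f' n = f n from if_pos hn]
    · rw [show f' n = Sum.inl 0 from if_neg hn]
      exact List.mem_cons_self
  · rw [listVal_map_range (hk.lt_of_mem_varsOf hv)]
    exact if_pos (mem_candidates (hf.mem_adom hv))

/-- All variables of the tgds of `S` are smaller than `k`. -/
def VarsBelow (k : ℕ) (S : List TGD) : Prop :=
  ∀ ξ ∈ S, IndicesBelow k (TGD.body ξ ++ TGD.head ξ).toFinset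

theorem exists_varsBelow (S : List TGD) : ∃ k, VarsBelow k S := by
  obtain ⟨k, hk⟩ :=
    exists_indicesBelow (S.flatMap fun ξ => TGD.body ξ ++ TGD.head ξ).toFinset
  refine ⟨k, fun ξ hξ => hk.subset fun a ha => ?_⟩
  exact List.mem_toFinset.2 (List.mem_flatMap.2 ⟨ξ, hξ, List.mem_toFinset.1 ha⟩)

/-- A bounded form of `Model`, for tgds with variables below `k`: assignments are replaced by
tuples of candidates. -/
def BoundedModel (S : List TGD) (U : List (Atom Value)) (k : ℕ) : Prop :=
  ∀ ξ ∈ S, ∀ l ∈ tuples (candidates U) k, MapsInto (listVal l) (TGD.body ξ) U.toFinset →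
    ∃ l' ∈ tuples (candidates U) k,
      (∀ a ∈ TGD.body ξ, Atom.map (termVal (listVal l')) a = Atom.map (termVal (listVal l)) a) ∧
      MapsInto (listVal l') (TGD.head ξ) U.toFinset

theorem forall_map_termVal_eq_iff : (∀ a ∈ L, Atom.map (termVal f) a = Atom.map (termVal g) a) ↔
    ∀ v ∈ varsOf L, f v = g v := by
  simp only [Atom.map_eq_map_iff, mem_varsOf]
  refine ⟨fun h v ⟨a, ha, hv⟩ => h a ha _ hv, fun h a ha x hx => ?_⟩
  rcases x with c | v
  · rfl
  · exact h v ⟨a, ha, hx⟩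

theorem BoundedModel.model (h : BoundedModel S U k) (hk : VarsBelow k S) :
    Model S.toFinset U.toFinset := by
  intro ξ hξ f hf
  rw [List.mem_toFinset] at hξ
  obtain ⟨l, hl, hlf⟩ := exists_mem_tuples_listVal_eq hf
    ((hk ξ hξ).subset (List.toFinset_append (α := Atom Term) ▸ Finset.subset_union_left))
  obtain ⟨l', -, hbody, hhead⟩ := h ξ hξ l hl (hf.congr fun v hv => (hlf v hv).symm)
  exact ⟨listVal l', fun v hv => (forall_map_termVal_eq_iff.1 hbody v hv).trans (hlf v hv), hhead⟩

theorem Model.boundedModel (h : Model S.toFinset U.toFinset) (hk : VarsBelow k S) :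
    BoundedModel S U k := by
  intro ξ hξ l _ hbody
  obtain ⟨g, hgl, hhead⟩ := h ξ (List.mem_toFinset.2 hξ) (listVal l) hbody
  obtain ⟨l', hl', hlg⟩ := exists_mem_tuples_listVal_eq
    (mapsInto_append.2 ⟨hbody.congr fun v hv => (hgl v hv).symm, hhead⟩) (hk ξ hξ)
  have hvars : ∀ v, v ∈ varsOf (TGD.body ξ) ∨ v ∈ varsOf (TGD.head ξ) → listVal l' v = g v :=
    fun v hv =>
      hlg v (by simpa only [mem_varsOf, List.mem_append, or_and_right, exists_or] using hv)
  refine ⟨l', hl', forall_map_termVal_eq_iff.2 fun v hv => ?_, hhead.congr fun v hv => ?_⟩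
  · rw [hvars v (Or.inl hv), hgl v hv]
  · exact (hvars v (Or.inr hv)).symm

/-- The instruction to fire the trigger with tgd `ξ` and assignment `listVal l`, using nulls from
`N` on, stored as `(ξ, l, N)`. -/
abbrev Firing : Type := TGD × List Value × ℕ

/-- The firing `t` is a step of a derivation with `S` on `J`. -/
def CanFire (S : List TGD) (J : List (Atom Value)) (t : Firing) : Prop :=
  t.1 ∈ S ∧ MapsInto (listVal t.2.1) (TGD.body t.1) J.toFinset ∧ IndicesBelow t.2.2 J.toFinset

open Classical in
/-- Carry out the firing `t` if possible. -/
noncomputable def fireOne (S : List TGD) (J : List (Atom Value)) (t : Firing) :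
    List (Atom Value) :=
  if CanFire S J t then
    J ++ (TGD.head t.1).map (Atom.map (termVal (freshExt t.1 (listVal t.2.1) t.2.2)))
  else J

/-- Carry out a list of firings one after the other. -/
noncomputable def fireAll (S : List TGD) (I : List (Atom Value)) (T : List Firing) :
    List (Atom Value) :=
  T.foldl (fireOne S) I

theorem fireAll_append_singleton (S : List TGD) (I : List (Atom Value)) (T : List Firing)
    (t : Firing) : fireAll S I (T ++ [t]) = fireOne S (fireAll S I T) t := by
  simp [fireAll]

theorem toFinset_fireOne {J : List (Atom Value)} {t : Firing} (ht : CanFire S J t) :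
    (fireOne S J t).toFinset = J.toFinset ∪ fired t.1 (listVal t.2.1) t.2.2 := by
  rw [fireOne, if_pos ht, List.toFinset_append, fired]

theorem deriv_fireAll (S : List TGD) (I : List (Atom Value)) (T : List Firing) :
    Deriv S.toFinset I.toFinset (fireAll S I T).toFinset := by
  induction T using List.reverseRecOn with
  | nil => exact Deriv.refl
  | append_singleton T t ih =>
    rw [fireAll_append_singleton]
    by_cases ht : CanFire S (fireAll S I T) t
    · rw [toFinset_fireOne ht]
      exact ih.step t.1 (listVal t.2.1) t.2.2 (List.mem_toFinset.2 ht.1) ht.2.1 ht.2.2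
    · rwa [fireOne, if_neg ht]

theorem fired_congr {ξ : TGD} (h : ∀ v ∈ varsOf (TGD.body ξ), f v = g v) :
    fired ξ f N = fired ξ g N := by
  have hext : freshExt ξ f N = freshExt ξ g N := funext fun v => by
    by_cases hv : v ∈ varsOf (TGD.body ξ)
    · rw [freshExt_of_mem hv, freshExt_of_mem hv, h v hv]
    · rw [freshExt_of_notMem hv, freshExt_of_notMem hv]
  rw [fired, fired, hext]

theorem Deriv.exists_fireAll {J : Instance} (h : Deriv S.toFinset I.toFinset J) :
    ∃ T, (fireAll S I T).toFinset = J := by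
  induction h with
  | refl => exact ⟨[], rfl⟩
  | step ξ f N _ hξ hf hN ih =>
    obtain ⟨T, rfl⟩ := ih
    obtain ⟨k, hk⟩ := exists_indicesBelow (TGD.body ξ).toFinset
    let l := (List.range k).map f
    have hl : ∀ v ∈ varsOf (TGD.body ξ), f v = listVal l v := fun v hv =>
      (listVal_map_range (hk.lt_of_mem_varsOf hv)).symm
    have hfire : CanFire S (fireAll S I T) (ξ, l, N) :=
      ⟨List.mem_toFinset.1 hξ, hf.congr hl, hN⟩
    exact ⟨T ++ [(ξ, l, N)], by
      rw [fireAll_append_singleton, toFinset_fireOne hfire, fired_congr hl]⟩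

/-- The firings `T` derive an instance from `I` which is homomorphically equivalent to the model
`U`: `p` maps `I` to `U`, `q` maps `U` to the derived instance, and `k` bounds the variables
of `S`. -/
def Certifies (I : List (Atom Value)) (S : List TGD) (T : List Firing) (U : List (Atom Value))
    (p q : List Value) (k : ℕ) : Prop :=
  Sends (listVal p) I.toFinset U.toFinset ∧
    Sends (listVal q) U.toFinset (fireAll S I T).toFinset ∧ VarsBelow k S ∧ BoundedModel S U k

theorem mem_CTcore_iff_exists_certifies : S.toFinset ∈ CTcore I.toFinset ↔
    ∃ T U p q k, Certifies I S T U p q k := by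
  refine coreChaseTerminates_iff.trans ⟨?_, ?_⟩
  · rintro ⟨J, U, hJ, hUJ, hIU, hU⟩
    obtain ⟨T, rfl⟩ := hJ.exists_fireAll
    obtain ⟨p, hp⟩ := hIU.exists_sends_listVal
    obtain ⟨q, hq⟩ := hUJ.exists_sends_listVal
    obtain ⟨k, hk⟩ := exists_varsBelow S
    rw [← U.toList_toFinset] at hp hq hU
    exact ⟨T, U.toList, p, q, k, hp, hq, hk, hU.boundedModel hk⟩
  · rintro ⟨T, U, p, q, k, hp, hq, hk, hU⟩
    exact ⟨_, U.toFinset, deriv_fireAll S I T, ⟨_, hq⟩, ⟨_, hp⟩, hU.model hk⟩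

end Certificates

/-! ### Recursive enumerability -/

section Primrec

variable {α β T U : Type} [Primcodable α] [Primcodable β] [Primcodable T] [Primcodable U]

theorem primrecPred_forall_mem {L : β → List α} {R : β → α → Prop} (hL : Primrec L)
    (hR : PrimrecPred fun p : β × α => R p.1 p.2) : PrimrecPred fun b => ∀ a ∈ L b, R b a := by
  have hrel : PrimrecRel fun (a : α) (b : β) => R b a :=
    hR.comp (Primrec.pair Primrec.snd Primrec.fst)
  exact hrel.forall_mem_list.comp hL Primrec.id

theorem primrecPred_exists_mem {L : β → List α} {R : β → α → Prop} (hL : Primrec L)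
    (hR : PrimrecPred fun p : β × α => R p.1 p.2) : PrimrecPred fun b => ∃ a ∈ L b, R b a := by
  have hrel : PrimrecRel fun (a : α) (b : β) => R b a :=
    hR.comp (Primrec.pair Primrec.snd Primrec.fst)
  exact hrel.exists_mem_list.comp hL Primrec.id

theorem primrecPred_mem {L : β → List α} {f : β → α} (hf : Primrec f) (hL : Primrec L) :
    PrimrecPred fun b => f b ∈ L b :=
  (primrecPred_exists_mem (R := fun b a => f b = a) hL
    (Primrec.eq.comp (hf.comp Primrec.fst) Primrec.snd)).of_eq fun b => by simp

theorem primrecPred_imp {p q : α → Prop} (hp : PrimrecPred p) (hq : PrimrecPred q) :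
    PrimrecPred fun a => p a → q a :=
  (hp.not.or hq).of_eq fun _ => imp_iff_not_or.symm

theorem rePred_exists {p : α → β → Prop} (hp : PrimrecPred fun x : α × β => p x.1 x.2) :
    REPred fun a => ∃ b, p a b := by
  obtain ⟨_, hdecide⟩ := hp
  have : ∀ a b, Decidable (p a b) := fun a b =>
    inferInstanceAs (Decidable ((fun x : α × β => p x.1 x.2) (a, b)))
  replace hdecide : Primrec fun x : α × β => decide (p x.1 x.2) := hdecide.of_eq fun x => by congr
  let search : α → ℕ → Option Unit := fun a n =>
    (Encodable.decode (α := β) n).bind fun b => bif decide (p a b) then some () else none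
  have hsearch : Computable₂ search :=
    (Primrec.option_bind (Primrec.decode.comp Primrec.snd) (Primrec.cond
      (hdecide.comp (Primrec.pair (Primrec.fst.comp Primrec.fst) Primrec.snd))
      (Primrec.const _) (Primrec.const _)).to₂).to_comp
  refine (Partrec.rfindOpt hsearch).dom_re.of_eq fun a => ?_
  rw [Nat.rfindOpt_dom]
  constructor
  · rintro ⟨n, u, hu⟩
    obtain ⟨b, -, hb⟩ := Option.bind_eq_some_iff.1 hu
    exact ⟨b, by_contra fun hn => by simp [hn] at hb⟩
  · rintro ⟨b, hb⟩
    exact ⟨Encodable.encode b, (), by simp [search, hb]⟩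

theorem primrec_atom_map {g : β → T → U} {a : β → Atom T} (hg : Primrec₂ g) (ha : Primrec a) :
    Primrec fun b => Atom.map (g b) (a b) :=
  Primrec.pair (Primrec.fst.comp ha)
    (Primrec.pair (hg.comp Primrec.id (Primrec.fst.comp (Primrec.snd.comp ha)))
      (Primrec.list_map (Primrec.snd.comp (Primrec.snd.comp ha)) hg))

theorem primrec_atom_args : Primrec (Atom.args : Atom T → List T) :=
  Primrec.list_cons.comp (Primrec.fst.comp Primrec.snd) (Primrec.snd.comp Primrec.snd)

theorem primrec_termVal {f : β → ℕ → Value} (hf : Primrec₂ f) :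
    Primrec₂ fun b x => termVal (f b) x := by
  refine (Primrec.sumCasesOn (f := fun p : β × Term => p.2) (g := fun _ c => Sum.inl c)
    (h := fun p v => f p.1 v) Primrec.snd (Primrec.sumInl.comp Primrec.snd).to₂
    (hf.comp (Primrec.fst.comp Primrec.fst) Primrec.snd).to₂).of_eq ?_
  rintro ⟨b, c | v⟩ <;> rfl

end Primrec

section Check

variable {β : Type} [Primcodable β] {S : β → List TGD} {I U : β → List (Atom Value)}
  {L : β → List (Atom Term)} {l : β → List Value} {k : β → ℕ}

theorem primrec_map_listVal {a : β → Atom (ℕ ⊕ ℕ)} (hl : Primrec l) (ha : Primrec a) :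
    Primrec fun b => Atom.map (termVal (listVal (l b))) (a b) :=
  primrec_atom_map (primrec_termVal
    ((Primrec.list_getD _).comp (hl.comp Primrec.fst) Primrec.snd).to₂) ha

theorem primrecPred_mapsInto (hl : Primrec l) (hL : Primrec L) (hU : Primrec U) :
    PrimrecPred fun b => MapsInto (listVal (l b)) (L b) (U b).toFinset :=
  (primrecPred_forall_mem (R := fun b a => Atom.map (termVal (listVal (l b))) a ∈ U b) hL
    (primrecPred_mem (primrec_map_listVal (hl.comp Primrec.fst) Primrec.snd)
      (hU.comp Primrec.fst))).of_eq fun b => by simp only [MapsInto, List.mem_toFinset]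

theorem primrecPred_sends (hl : Primrec l) (hI : Primrec I) (hU : Primrec U) :
    PrimrecPred fun b => Sends (listVal (l b)) (I b).toFinset (U b).toFinset :=
  (primrecPred_mapsInto hl hI hU).of_eq fun b => by
    simp only [Sends, MapsInto, List.mem_toFinset]

theorem primrecPred_indicesBelow (hk : Primrec k) (hL : Primrec L) :
    PrimrecPred fun b => IndicesBelow (k b) (L b).toFinset := by
  have hrank : Primrec rank :=
    (Primrec.sumCasesOn (f := id) (g := fun _ _ => 0) (h := fun _ n => n + 1) Primrec.id
      (Primrec.const 0).to₂ (Primrec.succ.comp Primrec.snd).to₂).of_eq (by rintro (c | n) <;> rfl)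
  refine (primrecPred_forall_mem (R := fun b a => ∀ x ∈ Atom.args a, rank x ≤ k b) hL
    (primrecPred_forall_mem (primrec_atom_args.comp Primrec.snd) (Primrec.nat_le.comp
      (hrank.comp Primrec.snd) (hk.comp (Primrec.fst.comp Primrec.fst))))).of_eq fun b => ?_
  simp only [IndicesBelow, mem_adom, List.mem_toFinset]
  exact ⟨fun h x ⟨a, ha, hx⟩ => h a ha x hx, fun h a ha x hx => h x ⟨a, ha, hx⟩⟩

theorem primrec_body : Primrec TGD.body := Primrec.fst

theorem primrec_head : Primrec TGD.head := Primrec.snd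

theorem primrecPred_varsBelow (hk : Primrec k) (hS : Primrec S) :
    PrimrecPred fun b => VarsBelow (k b) (S b) :=
  primrecPred_forall_mem hS (primrecPred_indicesBelow (hk.comp Primrec.fst)
    (Primrec.list_append.comp (primrec_body.comp Primrec.snd) (primrec_head.comp Primrec.snd)))

theorem primrec_tuples (hl : Primrec l) (hk : Primrec k) :
    Primrec fun b => tuples (l b) (k b) := by
  have hcons : Primrec₂ fun (p : β × ℕ × List (List Value)) (t : List Value) =>
      (l p.1).map fun x => x :: t :=
    Primrec.list_map (hl.comp (Primrec.fst.comp Primrec.fst))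
      (Primrec.list_cons.comp Primrec.snd (Primrec.snd.comp Primrec.fst)).to₂
  have hstep : Primrec₂ fun (b : β) (p : ℕ × List (List Value)) =>
      p.2.flatMap fun t => (l b).map fun x => x :: t :=
    Primrec.list_flatMap (Primrec.snd.comp Primrec.snd) hcons
  refine (Primrec.nat_rec' hk (Primrec.const [[]]) hstep).of_eq fun b => ?_
  induction k b with
  | zero => rfl
  | succ k ih => simp only [tuples, ← ih]

theorem primrec_candidates : Primrec candidates :=
  Primrec.list_cons.comp (Primrec.const _)
    (Primrec.list_flatMap (g := fun _ => Atom.args) Primrec.id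
      (primrec_atom_args.comp Primrec.snd).to₂)

theorem primrecPred_boundedModel (hS : Primrec S) (hU : Primrec U) (hk : Primrec k) :
    PrimrecPred fun b => BoundedModel (S b) (U b) (k b) := by
  have htuples : Primrec fun b => tuples (candidates (U b)) (k b) :=
    primrec_tuples (primrec_candidates.comp hU) hk
  refine primrecPred_forall_mem hS (primrecPred_forall_mem (htuples.comp Primrec.fst)
    (primrecPred_imp (primrecPred_mapsInto Primrec.snd ?_ ?_) (primrecPred_exists_mem
      (htuples.comp (Primrec.fst.comp Primrec.fst)) (PrimrecPred.and
        (primrecPred_forall_mem ?_ (Primrec.eq.comp (primrec_map_listVal ?_ Primrec.snd)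
          (primrec_map_listVal ?_ Primrec.snd))) (primrecPred_mapsInto Primrec.snd ?_ ?_)))))
  · exact primrec_body.comp (Primrec.snd.comp Primrec.fst)
  · exact hU.comp (Primrec.fst.comp Primrec.fst)
  · exact primrec_body.comp (Primrec.snd.comp (Primrec.fst.comp Primrec.fst))
  · exact Primrec.snd.comp Primrec.fst
  · exact Primrec.snd.comp (Primrec.fst.comp Primrec.fst)
  · exact primrec_head.comp (Primrec.snd.comp (Primrec.fst.comp Primrec.fst))
  · exact hU.comp (Primrec.fst.comp (Primrec.fst.comp Primrec.fst))

theorem primrec_freshExt :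
    Primrec₂ fun (t : Firing) v => freshExt t.1 (listVal t.2.1) t.2.2 v := by
  have hvars : PrimrecPred fun p : Firing × ℕ => p.2 ∈ varsOf (TGD.body p.1.1) :=
    (primrecPred_mem (Primrec.sumInr.comp Primrec.snd) (Primrec.list_flatMap
      (primrec_body.comp (Primrec.fst.comp Primrec.fst))
      (primrec_atom_args.comp Primrec.snd).to₂)).of_eq fun p => by
        rw [mem_varsOf, List.mem_flatMap]
  exact Primrec.ite hvars
    ((Primrec.list_getD _).comp (Primrec.fst.comp (Primrec.snd.comp Primrec.fst)) Primrec.snd)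
    (Primrec.sumInr.comp (Primrec.nat_add.comp
      (Primrec.snd.comp (Primrec.snd.comp Primrec.fst)) Primrec.snd))

theorem primrecPred_canFire {J : β → List (Atom Value)} {t : β → Firing} (hS : Primrec S)
    (hJ : Primrec J) (ht : Primrec t) : PrimrecPred fun b => CanFire (S b) (J b) (t b) :=
  (primrecPred_mem (Primrec.fst.comp ht) hS).and
    ((primrecPred_mapsInto (Primrec.fst.comp (Primrec.snd.comp ht))
      (primrec_body.comp (Primrec.fst.comp ht)) hJ).and
    (primrecPred_indicesBelow (Primrec.snd.comp (Primrec.snd.comp ht)) hJ))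

theorem primrec_fireOne {J : β → List (Atom Value)} {t : β → Firing} (hS : Primrec S)
    (hJ : Primrec J) (ht : Primrec t) : Primrec fun b => fireOne (S b) (J b) (t b) := by
  classical
  have hnew : Primrec fun b => (TGD.head (t b).1).map
      (Atom.map (termVal (freshExt (t b).1 (listVal (t b).2.1) (t b).2.2))) :=
    Primrec.list_map (primrec_head.comp (Primrec.fst.comp ht))
      (primrec_atom_map ((primrec_termVal primrec_freshExt).comp
        (ht.comp (Primrec.fst.comp Primrec.fst)) Primrec.snd).to₂ Primrec.snd).to₂
  exact Primrec.ite (primrecPred_canFire hS hJ ht) (Primrec.list_append.comp hJ hnew) hJ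

theorem primrec_fireAll {T : β → List Firing} (hS : Primrec S) (hI : Primrec I)
    (hT : Primrec T) : Primrec fun b => fireAll (S b) (I b) (T b) :=
  Primrec.list_foldl (h := fun b p => fireOne (S b) p.1 p.2) hT hI
    (primrec_fireOne (hS.comp Primrec.fst) (Primrec.fst.comp Primrec.snd)
      (Primrec.snd.comp Primrec.snd)).to₂

theorem primrecPred_certifies {T : β → List Firing} {p q : β → List Value} (hI : Primrec I)
    (hS : Primrec S) (hT : Primrec T) (hU : Primrec U) (hp : Primrec p) (hq : Primrec q)
    (hk : Primrec k) :
    PrimrecPred fun b => Certifies (I b) (S b) (T b) (U b) (p b) (q b) (k b) :=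
  (primrecPred_sends hp hI hU).and ((primrecPred_sends hq hU (primrec_fireAll hS hI hT)).and
    ((primrecPred_varsBelow hk hS).and (primrecPred_boundedModel hS hU hk)))

end Check

theorem rePred_mem_CTcore : REPred fun P : List (Atom Value) × List TGD =>
    P.2.toFinset ∈ CTcore P.1.toFinset := by
  refine (rePred_exists (p := fun (P : List (Atom Value) × List TGD)
    (c : List Firing × List (Atom Value) × List Value × List Value × ℕ) =>
      Certifies P.1 P.2 c.1 c.2.1 c.2.2.1 c.2.2.2.1 c.2.2.2.2) ?_).of_eq fun P => ?_
  · have htail := Primrec.snd.comp (Primrec.snd.comp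
      (Primrec.snd (α := List (Atom Value) × List TGD)
        (β := List Firing × List (Atom Value) × List Value × List Value × ℕ)))
    exact primrecPred_certifies (Primrec.fst.comp Primrec.fst) (Primrec.snd.comp Primrec.fst)
      (Primrec.fst.comp Primrec.snd) (Primrec.fst.comp (Primrec.snd.comp Primrec.snd))
      (Primrec.fst.comp htail) (Primrec.fst.comp (Primrec.snd.comp htail))
      (Primrec.snd.comp (Primrec.snd.comp htail))
  · simp only [Prod.exists, mem_CTcore_iff_exists_certifies]

theorem rePred_mem_CTcore_of_instance (I : Instance) :
    REPred fun S : List TGD => S.toFinset ∈ CTcore I := by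
  have hpair : Computable fun S : List TGD => (I.toList, S) :=
    (Computable.const _).pair Computable.id
  have hmem : REPred fun S : List TGD => S.toFinset ∈ CTcore I.toList.toFinset :=
    Partrec.comp rePred_mem_CTcore hpair
  rwa [Finset.toList_toFinset] at hmem

/-! ### Rewriting of binary trees at the root -/

/-- Binary trees with labelled leaves, the configurations of the rewriting systems below. -/
inductive BinTree (α : Type) : Type
  | leaf (a : α)
  | node (l r : BinTree α)
  deriving DecidableEq

/-- Patterns are trees whose leaves are terms, hence constants or variables. -/
abbrev Pattern : Type := BinTree Term

namespace BinTree

/-- Replacement of the variables of a pattern by trees. -/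
def subst (σ : ℕ → BinTree ℕ) : Pattern → BinTree ℕ
  | leaf (Sum.inl c) => leaf c
  | leaf (Sum.inr v) => σ v
  | node l r => node (subst σ l) (subst σ r)

/-- A tree as a pattern without variables. -/
def ground : BinTree ℕ → Pattern
  | leaf c => leaf (Sum.inl c)
  | node l r => node (ground l) (ground r)

/-- The occurrences of subpatterns other than constants: these are the subpatterns which are
represented by variables in tgds. -/
def subs : Pattern → List Pattern
  | leaf (Sum.inl _) => []
  | leaf (Sum.inr v) => [leaf (Sum.inr v)]
  | node l r => node l r :: (subs l ++ subs r)

/-- The patterns differ at a position where both have a constant or a node, so that they cannot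
match the same tree. -/
def clash : Pattern → Pattern → Bool
  | leaf (Sum.inl c), leaf (Sum.inl d) => c != d
  | leaf (Sum.inl _), node _ _ => true
  | node _ _, leaf (Sum.inl _) => true
  | node a b, node c d => clash a c || clash b d
  | _, _ => false

/-- The tree is not a leaf. -/
def isNode {α : Type} : BinTree α → Bool
  | leaf _ => false
  | node _ _ => true

variable {σ τ : ℕ → BinTree ℕ}

theorem subst_ground : ∀ t : BinTree ℕ, subst σ (ground t) = t
  | leaf _ => rfl
  | node a b => by rw [ground, subst, subst_ground a, subst_ground b]

theorem leaf_notMem_subs_ground (v : ℕ) : ∀ t : BinTree ℕ, leaf (Sum.inr v) ∉ subs (ground t)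
  | leaf _ => by simp [ground, subs]
  | node a b => by
    simp [ground, subs, leaf_notMem_subs_ground v a, leaf_notMem_subs_ground v b]

theorem subst_ne_of_clash : ∀ {p q : Pattern}, clash p q → subst σ p ≠ subst τ q
  | leaf (Sum.inl c), leaf (Sum.inl d), h => by simpa [clash, subst] using h
  | leaf (Sum.inl _), node _ _, _ => by simp [subst]
  | node _ _, leaf (Sum.inl _), _ => by simp [subst]
  | node a b, node c d, h => by
    rw [subst, subst, ne_eq, node.injEq, not_and_or]
    exact (Bool.or_eq_true_iff.1 h).imp subst_ne_of_clash subst_ne_of_clash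

theorem subst_eq_subst_iff : ∀ {p : Pattern},
    p.subst σ = p.subst τ ↔ ∀ v, leaf (Sum.inr v) ∈ p.subs → σ v = τ v
  | leaf (Sum.inl _) => by simp [subst, subs]
  | leaf (Sum.inr v) => by simp [subst, subs]
  | node a b => by
    simp only [subst, subs, node.injEq, subst_eq_subst_iff (p := a), subst_eq_subst_iff (p := b),
      List.mem_cons, List.mem_append, reduceCtorEq, false_or, or_imp, forall_and]

end BinTree

open BinTree

section RootRewriting

variable {R : List (Pattern × Pattern)} {ρ ρ' : Pattern × Pattern}

/-- The tree `s` is rewritten to `t` by one of the rules in `R`, applied at the root. -/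
def Rewrites (R : List (Pattern × Pattern)) (s t : BinTree ℕ) : Prop :=
  ∃ ρ ∈ R, ∃ σ, ρ.1.subst σ = s ∧ ρ.2.subst σ = t

/-- The conditions under which root rewriting is deterministic and can be simulated by tgds that
create a copy of the right side of a rule next to a copy of the left side. -/
structure WellFormed (R : List (Pattern × Pattern)) : Prop where
  lhs_linear : ∀ ρ ∈ R, ρ.1.subs.Nodup
  rhs_isNode : ∀ ρ ∈ R, ρ.2.isNode
  rhs_notMem : ∀ ρ ∈ R, ρ.2 ∉ ρ.1.subs
  rhs_subs : ∀ ρ ∈ R, ∀ q ∈ ρ.2.subs, q ∈ ρ.1.subs ∨ q.isNode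
  clash : ∀ ρ ∈ R, ∀ ρ' ∈ R, ρ = ρ' ∨ clash ρ.1 ρ'.1

namespace WellFormed

theorem leaf_mem_lhs (hR : WellFormed R) (hρ : ρ ∈ R) {v : ℕ}
    (hv : leaf (Sum.inr v) ∈ ρ.2.subs) : leaf (Sum.inr v) ∈ ρ.1.subs :=
  (hR.rhs_subs ρ hρ _ hv).resolve_right Bool.false_ne_true

theorem rewrites_unique (hR : WellFormed R) {s t t' : BinTree ℕ} (ht : Rewrites R s t)
    (ht' : Rewrites R s t') : t = t' := by
  obtain ⟨ρ, hρ, σ, hσ, rfl⟩ := ht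
  obtain ⟨ρ', hρ', σ', hσ', rfl⟩ := ht'
  obtain rfl : ρ = ρ' := (hR.clash ρ hρ ρ' hρ').resolve_right fun hc =>
    subst_ne_of_clash hc (hσ.trans hσ'.symm)
  exact subst_eq_subst_iff.2 fun v hv =>
    subst_eq_subst_iff.1 (hσ.trans hσ'.symm) v (hR.leaf_mem_lhs hρ hv)

end WellFormed

open Classical in
/-- The transition function of a well-formed rewriting system. -/
noncomputable def next (R : List (Pattern × Pattern)) (s : BinTree ℕ) : Option (BinTree ℕ) :=
  if h : ∃ t, Rewrites R s t then some h.choose else none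

theorem mem_next (hR : WellFormed R) {s t : BinTree ℕ} : t ∈ next R s ↔ Rewrites R s t := by
  unfold next
  split_ifs with h
  · rw [Option.mem_some_iff]
    exact ⟨fun e => e ▸ h.choose_spec, hR.rewrites_unique h.choose_spec⟩
  · exact ⟨nofun, fun ht => absurd ⟨t, ht⟩ h⟩

end RootRewriting

/-! ### A rewriting system that evaluates partial recursive functions -/

open Turing.ToPartrec StateTransition

/-- A natural number as a tree. -/
def natTree : ℕ → BinTree ℕ
  | 0 => leaf 0
  | n + 1 => node (leaf 0) (natTree n)

/-- A list of natural numbers as a tree. -/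
def listTree : List ℕ → BinTree ℕ
  | [] => leaf 0
  | m :: v => node (natTree m) (listTree v)

/-- A code as a tree. -/
def codeTree : Code → BinTree ℕ
  | .zero' => leaf 0
  | .succ => leaf 1
  | .tail => leaf 2
  | .cons f g => node (leaf 3) (node (codeTree f) (codeTree g))
  | .comp f g => node (leaf 4) (node (codeTree f) (codeTree g))
  | .case f g => node (leaf 5) (node (codeTree f) (codeTree g))
  | .fix f => node (leaf 6) (codeTree f)

/-- A continuation as a tree. -/
def contTree : Cont → BinTree ℕ
  | .halt => leaf 0
  | .cons₁ f as k => node (leaf 1) (node (codeTree f) (node (listTree as) (contTree k)))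
  | .cons₂ ns k => node (leaf 2) (node (listTree ns) (contTree k))
  | .comp f k => node (leaf 3) (node (codeTree f) (contTree k))
  | .fix f k => node (leaf 4) (node (codeTree f) (contTree k))

/-- The configuration in which the code `f` is evaluated on `v` with the continuation `k`. Mathlib's
`Cfg` has no such state, as `stepNormal` works through a code in a single step. -/
def evalTree (f : Code) (k : Cont) (v : List ℕ) : BinTree ℕ :=
  node (leaf 0) (node (codeTree f) (node (contTree k) (listTree v)))

/-- A configuration as a tree. -/
def cfgTree : Cfg → BinTree ℕ
  | .ret k v => node (leaf 1) (node (contTree k) (listTree v))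
  | .halt v => node (leaf 2) (listTree v)

namespace Interpreter

/-- A constant as a pattern. -/
def const (i : ℕ) : Pattern := leaf (Sum.inl i)

/-- A variable as a pattern. -/
def var (i : ℕ) : Pattern := leaf (Sum.inr i)

/-- The pattern of `evalTree`. -/
def eval (f k v : Pattern) : Pattern := node (const 0) (node f (node k v))

/-- The pattern of `cfgTree` for the configurations `Cfg.ret`. -/
def ret (k v : Pattern) : Pattern := node (const 1) (node k v)

/-- The rewriting rules of the interpreter: first the cases of `stepNormal`, then those of
`stepRet`. The numbers stand for the constructors in the order of `codeTree` and `contTree`. -/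
def rules : List (Pattern × Pattern) :=
  let k := var 0
  let v := var 1
  let f := var 2
  let g := var 3
  let m := var 4
  let zero := const 0
  let nil := const 0
  let succ := node (const 0)
  let cons := node
  let as := var 3
  [(eval (const 0) k v, ret k (cons zero v)),
   (eval (const 1) k nil, ret k (cons (succ zero) nil)),
   (eval (const 1) k (cons m v), ret k (cons (succ m) nil)),
   (eval (const 2) k nil, ret k nil),
   (eval (const 2) k (cons m v), ret k v),
   (eval (node (const 3) (node f g)) k v, eval f (node (const 1) (node g (node v k))) v),
   (eval (node (const 4) (node f g)) k v, eval g (node (const 3) (node f k)) v),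
   (eval (node (const 5) (node f g)) k nil, eval f k nil),
   (eval (node (const 5) (node f g)) k (cons zero v), eval f k v),
   (eval (node (const 5) (node f g)) k (cons (succ m) v), eval g k (cons m v)),
   (eval (node (const 6) f) k v, eval f (node (const 4) (node f k)) v),
   (ret (const 0) v, node (const 2) v),
   (ret (node (const 1) (node f (node as k))) v, eval f (node (const 2) (node v k)) as),
   (ret (node (const 2) (node nil k)) v, ret k (cons zero v)),
   (ret (node (const 2) (node (cons m as) k)) v, ret k (cons m v)),
   (ret (node (const 3) (node f k)) v, eval f k v),
   (ret (node (const 4) (node f k)) nil, ret k nil),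
   (ret (node (const 4) (node f k)) (cons zero v), ret k v),
   (ret (node (const 4) (node f k)) (cons (succ m) v), eval f (node (const 4) (node f k)) v)]

theorem wellFormed_rules : WellFormed rules where
  lhs_linear := by decide +kernel
  rhs_isNode := by decide +kernel
  rhs_notMem := by decide +kernel
  rhs_subs := by decide +kernel
  clash := by decide +kernel

theorem next_rule (i : ℕ) (l : List (BinTree ℕ)) (hi : i < rules.length := by decide) :
    rules[i].2.subst (l.getD · (leaf 0)) ∈ next rules (rules[i].1.subst (l.getD · (leaf 0))) :=
  (mem_next wellFormed_rules).2 ⟨rules[i], List.getElem_mem hi, _, rfl, rfl⟩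

theorem reaches_stepNormal (f : Code) (k : Cont) (v : List ℕ) :
    Reaches₁ (next rules) (evalTree f k v) (cfgTree (stepNormal f k v)) := by
  induction f generalizing k v with
  | zero' => exact .single (next_rule 0 [contTree k, listTree v])
  | succ =>
    rcases v with _ | ⟨m, v⟩
    · exact .single (next_rule 1 [contTree k])
    · exact .single (next_rule 2 [contTree k, listTree v, leaf 0, leaf 0, natTree m])
  | tail =>
    rcases v with _ | ⟨m, v⟩
    · exact .single (next_rule 3 [contTree k])
    · exact .single (next_rule 4 [contTree k, listTree v, leaf 0, leaf 0, natTree m])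
  | cons f g ihf =>
    exact .head (next_rule 5 [contTree k, listTree v, codeTree f, codeTree g])
      (ihf (.cons₁ g v k) v)
  | comp f g _ ihg =>
    exact .head (next_rule 6 [contTree k, listTree v, codeTree f, codeTree g]) (ihg (.comp f k) v)
  | case f g ihf ihg =>
    rcases v with _ | ⟨_ | m, v⟩
    · exact .head (next_rule 7 [contTree k, leaf 0, codeTree f, codeTree g]) (ihf k [])
    · exact .head (next_rule 8 [contTree k, listTree v, codeTree f, codeTree g]) (ihf k v)
    · exact .head (next_rule 9 [contTree k, listTree v, codeTree f, codeTree g, natTree m])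
        (ihg k (m :: v))
  | fix f ihf =>
    exact .head (next_rule 10 [contTree k, listTree v, codeTree f]) (ihf (.fix f k) v)

theorem reaches_stepRet (k : Cont) (v : List ℕ) :
    Reaches₁ (next rules) (cfgTree (.ret k v)) (cfgTree (stepRet k v)) := by
  induction k generalizing v with
  | halt => exact .single (next_rule 11 [leaf 0, listTree v])
  | cons₁ f as k =>
    exact .head (next_rule 12 [contTree k, listTree v, codeTree f, listTree as])
      (reaches_stepNormal f (.cons₂ v k) as)
  | cons₂ ns k ih =>
    rcases ns with _ | ⟨m, ns⟩
    · exact .head (next_rule 13 [contTree k, listTree v]) (ih (0 :: v))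
    · exact .head (next_rule 14 [contTree k, listTree v, leaf 0, listTree ns, natTree m])
        (ih (m :: v))
  | comp f k =>
    exact .head (next_rule 15 [contTree k, listTree v, codeTree f]) (reaches_stepNormal f k v)
  | fix f k ih =>
    rcases v with _ | ⟨_ | m, v⟩
    · exact .head (next_rule 16 [contTree k, leaf 0, codeTree f]) (ih [])
    · exact .head (next_rule 17 [contTree k, listTree v, codeTree f]) (ih v)
    · exact .head (next_rule 18 [contTree k, listTree v, codeTree f, leaf 0, natTree m])
        (reaches_stepNormal f (.fix f k) v)

theorem next_halt (v : List ℕ) : next rules (cfgTree (.halt v)) = none := by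
  have hclash : ∀ ρ ∈ rules, clash ρ.1 (node (const 2) (var 0)) := by decide
  rw [Option.eq_none_iff_forall_not_mem]
  intro t ht
  obtain ⟨ρ, hρ, σ, hσ, -⟩ := (mem_next wellFormed_rules).1 ht
  exact subst_ne_of_clash (τ := fun _ => listTree v) (hclash ρ hρ) hσ

theorem respects : Respects step (next rules) fun c t => cfgTree c = t := by
  rintro (v | ⟨k, v⟩) _ rfl
  · exact next_halt _
  · exact ⟨_, rfl, reaches_stepRet _ _⟩

theorem eval_dom_iff (f : Code) (v : List ℕ) : (f.eval v).Dom ↔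
    ∃ t, Relation.ReflTransGen (Rewrites rules) (evalTree f .halt v) t ∧
      ∀ t', ¬ Rewrites rules t t' := by
  have hdom : (f.eval v).Dom ↔ (StateTransition.eval (next rules) (evalTree f .halt v)).Dom := by
    rw [reaches_eval (reaches_stepNormal f .halt v).to_reflTransGen, tr_eval_dom respects rfl,
      stepNormal_eval]
    rfl
  have hnext : (fun s t => t ∈ next rules s) = Rewrites rules :=
    funext₂ fun _ _ => propext (mem_next wellFormed_rules)
  rw [hdom, Part.dom_iff_mem]
  refine exists_congr fun t => ?_
  rw [mem_eval, Option.eq_none_iff_forall_not_mem, Reaches, hnext]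
  exact and_congr_right' (forall_congr' fun _ => not_congr (mem_next wellFormed_rules))

end Interpreter

/-! ### Patterns as conjunctions of atoms -/

section Atoms

variable {T U : Type} {r : ℕ} {x y z x' y' z' : T}

theorem mem_varsOf_cons {v : ℕ} {α : Atom Term} {L : List (Atom Term)} :
    v ∈ varsOf (α :: L) ↔ Sum.inr v ∈ Atom.args α ∨ v ∈ varsOf L := by
  simp [mem_varsOf]

theorem mem_varsOf_append {v : ℕ} {L L' : List (Atom Term)} :
    v ∈ varsOf (L ++ L') ↔ v ∈ varsOf L ∨ v ∈ varsOf L' := by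
  simp [mem_varsOf, or_and_right, exists_or]

/-- The atom which says that `x` is a node with children `y` and `z`. -/
def cell (r : ℕ) (x y z : T) : Atom T := (r, x, [y, z])

/-- The atom which says that `y` is the root of the configuration that follows the one at `x`. -/
def edge (r : ℕ) (x y : T) : Atom T := (r, x, [y])

theorem cell_inj : cell r x y z = cell r x' y' z' ↔ x = x' ∧ y = y' ∧ z = z' := by simp [cell]

theorem edge_inj : edge r x y = edge r x' y' ↔ x = x' ∧ y = y' := by simp [edge]

theorem cell_ne_edge : cell r x y z ≠ edge r x' y' := by simp [cell, edge]

theorem map_cell (f : T → U) : Atom.map f (cell r x y z) = cell r (f x) (f y) (f z) := rfl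

theorem map_edge (f : T → U) : Atom.map f (edge r x y) = edge r (f x) (f y) := rfl

end Atoms

/-- The term that stands for the root of a tree whose children have the roots `s` and `t`. -/
def nodeTerm (s t : Term) : Term := Sum.inr (2 * Encodable.encode (s, t) + 1)

theorem nodeTerm_inj {s t s' t' : Term} :
    nodeTerm s t = nodeTerm s' t' ↔ s = s' ∧ t = t' := by
  rw [nodeTerm, nodeTerm, Sum.inr.injEq, Nat.add_right_cancel_iff, Nat.mul_right_inj two_ne_zero,
    Encodable.encode_inj, Prod.mk.injEq]

namespace BinTree

/-- The term that stands for the root of a pattern. Variables are moved to positive even indices,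
since odd ones are used for nodes and `0` for the source of the edge in the body of a rule. -/
def term : Pattern → Term
  | leaf (Sum.inl c) => Sum.inl c
  | leaf (Sum.inr v) => Sum.inr (2 * v + 2)
  | node a b => nodeTerm (term a) (term b)

/-- The atoms which say that the root of a pattern is the root of such a tree. -/
def atoms (r : ℕ) : Pattern → List (Atom Term)
  | leaf _ => []
  | node a b => cell r (term (node a b)) (term a) (term b) :: (atoms r a ++ atoms r b)

theorem term_injective : Function.Injective term
  | leaf (Sum.inl c), leaf (Sum.inl d), h => by simpa [term] using h
  | leaf (Sum.inl _), leaf (Sum.inr _), h => by simp [term] at h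
  | leaf (Sum.inr _), leaf (Sum.inl _), h => by simp [term] at h
  | leaf (Sum.inr v), leaf (Sum.inr w), h => by simpa [term] using h
  | leaf (Sum.inl _), node _ _, h => by simp [term, nodeTerm] at h
  | leaf (Sum.inr _), node _ _, h => by
    simp only [term, nodeTerm, Sum.inr.injEq] at h
    omega
  | node _ _, leaf (Sum.inl _), h => by simp [term, nodeTerm] at h
  | node _ _, leaf (Sum.inr _), h => by
    simp only [term, nodeTerm, Sum.inr.injEq] at h
    omega
  | node a b, node c d, h => by
    obtain ⟨hac, hbd⟩ := nodeTerm_inj.1 (by simpa only [term] using h)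
    rw [term_injective hac, term_injective hbd]

theorem term_ne_zero : ∀ p : Pattern, term p ≠ Sum.inr 0
  | leaf (Sum.inl _) => by simp [term]
  | leaf (Sum.inr _) => by simp [term]
  | node _ _ => by simp [term, nodeTerm]

variable {r v : ℕ} {p q a b : Pattern} {J : Instance} {f g : ℕ → Value}

theorem exists_term_eq_inr : ∀ {p : Pattern}, q ∈ p.subs → ∃ n, q.term = Sum.inr n
  | leaf (Sum.inl _), h => by simp [subs] at h
  | leaf (Sum.inr v), h => ⟨2 * v + 2, by rw [List.mem_singleton.1 h]; rfl⟩
  | node a b, h => by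
    rcases List.mem_cons.1 h with rfl | h
    · exact ⟨_, rfl⟩
    · exact (List.mem_append.1 h).elim exists_term_eq_inr exists_term_eq_inr

theorem mem_atoms {α : Atom Term} : ∀ {p : Pattern}, α ∈ atoms r p ↔
    ∃ a b, node a b ∈ p.subs ∧ α = cell r (term (node a b)) (term a) (term b)
  | leaf (Sum.inl _) => by simp [atoms, subs]
  | leaf (Sum.inr _) => by simp [atoms, subs]
  | node a b => by
    simp only [atoms, subs, List.mem_cons, List.mem_append, node.injEq, mem_atoms (p := a),
      mem_atoms (p := b), or_and_right, exists_or, and_assoc, exists_eq_left, exists_and_left]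

theorem term_eq_inr_or_mem_varsOf_atoms : ∀ {p : Pattern},
    p.term = Sum.inr v ∨ v ∈ varsOf (p.atoms r) ↔ ∃ q ∈ p.subs, q.term = Sum.inr v
  | leaf (Sum.inl _) => by simp [term, atoms, subs, varsOf]
  | leaf (Sum.inr _) => by simp [atoms, subs, varsOf]
  | node a b => by
    have iha := term_eq_inr_or_mem_varsOf_atoms (p := a)
    have ihb := term_eq_inr_or_mem_varsOf_atoms (p := b)
    have hatoms : v ∈ varsOf ((node a b).atoms r) ↔ (node a b).term = Sum.inr v ∨
        (a.term = Sum.inr v ∨ v ∈ varsOf (a.atoms r)) ∨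
          b.term = Sum.inr v ∨ v ∈ varsOf (b.atoms r) := by
      rw [atoms, mem_varsOf_cons, mem_varsOf_append]
      simp only [cell, Atom.args, List.mem_cons, List.not_mem_nil, or_false,
        eq_comm (a := Sum.inr v)]
      tauto
    simp only [hatoms, iha, ihb, subs, List.exists_mem_cons_iff, List.mem_append, or_and_right,
      exists_or, or_self_left]

theorem exists_termVal_eq (F : Pattern → Value) :
    ∃ h : ℕ → Value, ∀ p q : Pattern, q ∈ p.subs → termVal h q.term = F q := by
  have : Nonempty Pattern := ⟨leaf (Sum.inl 0)⟩
  refine ⟨fun v => F (Function.invFun term (Sum.inr v)), fun p q hq => ?_⟩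
  obtain ⟨n, hn⟩ := exists_term_eq_inr hq
  rw [hn]
  exact congrArg F (hn ▸ Function.leftInverse_invFun term_injective q)

theorem termVal_congr : ∀ {p : Pattern}, (∀ q ∈ p.subs, termVal f q.term = termVal g q.term) →
    termVal f p.term = termVal g p.term
  | leaf (Sum.inl _), _ => rfl
  | leaf (Sum.inr _), h => h _ List.mem_cons_self
  | node _ _, h => h _ List.mem_cons_self

theorem mapsInto_atoms_congr (hf : MapsInto f (p.atoms r) J)
    (h : ∀ q ∈ p.subs, termVal f q.term = termVal g q.term) : MapsInto g (p.atoms r) J := by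
  refine hf.congr fun v hv => ?_
  obtain ⟨q, hq, hqv⟩ := term_eq_inr_or_mem_varsOf_atoms.1 (Or.inr hv)
  simpa only [hqv, termVal, Sum.elim_inr] using h q hq

theorem mapsInto_atoms_node : MapsInto f ((node a b).atoms r) J ↔
    cell r (termVal f (node a b).term) (termVal f a.term) (termVal f b.term) ∈ J ∧
      MapsInto f (a.atoms r) J ∧ MapsInto f (b.atoms r) J := by
  simp only [MapsInto, atoms, List.forall_mem_cons, List.forall_mem_append, map_cell]

end BinTree

/-! ### Trees in instances -/

section Trees

variable {r : ℕ} {p a b : Pattern} {J : Instance} {f g : ℕ → Value}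

/-- `x` is the root of the tree `t` in `J`. -/
def Rep (r : ℕ) (J : Instance) : BinTree ℕ → Value → Prop
  | leaf c, x => x = Sum.inl c
  | node a b, x => ∃ y z, cell r x y z ∈ J ∧ Rep r J a y ∧ Rep r J b z

theorem Rep.mono {J' : Instance} (h : J ⊆ J') : ∀ {t : BinTree ℕ} {x : Value},
    Rep r J t x → Rep r J' t x
  | leaf _, _, hx => hx
  | node _ _, _, ⟨y, z, hc, ha, hb⟩ => ⟨y, z, h hc, Rep.mono h ha, Rep.mono h hb⟩

theorem rep_subst {σ : ℕ → BinTree ℕ} : ∀ {p : Pattern}, MapsInto f (p.atoms r) J →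
    (∀ v, leaf (Sum.inr v) ∈ p.subs → Rep r J (σ v) (f (2 * v + 2))) →
      Rep r J (p.subst σ) (termVal f p.term)
  | leaf (Sum.inl _), _, _ => rfl
  | leaf (Sum.inr v), _, h => h v List.mem_cons_self
  | node _ _, hf, h =>
    let ⟨hc, ha, hb⟩ := mapsInto_atoms_node.1 hf
    ⟨_, _, hc,
      rep_subst ha fun v hv => h v (List.mem_cons_of_mem _ (List.mem_append_left _ hv)),
      rep_subst hb fun v hv => h v (List.mem_cons_of_mem _ (List.mem_append_right _ hv))⟩

open Classical in
theorem exists_glue (hn : (node a b).subs.Nodup) (x : Value) (f g : ℕ → Value) :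
    ∃ h : ℕ → Value, termVal h (node a b).term = x ∧
      (∀ q ∈ a.subs, termVal f q.term = termVal h q.term) ∧
      ∀ q ∈ b.subs, termVal g q.term = termVal h q.term := by
  obtain ⟨hroot, hab⟩ := List.nodup_cons.1 hn
  obtain ⟨h, hh⟩ := exists_termVal_eq fun q => if q = node a b then x else
    if q ∈ a.subs then termVal f q.term else termVal g q.term
  refine ⟨h, ?_, fun q hq => ?_, fun q hq => ?_⟩
  · rw [hh (node a b) _ List.mem_cons_self, if_pos rfl]
  · rw [hh a q hq, if_neg, if_pos hq]
    exact fun e => hroot (List.mem_append_left _ (e ▸ hq))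
  · rw [hh b q hq, if_neg, if_neg fun hqa => (List.nodup_append.1 hab).2.2 q hqa q hq rfl]
    exact fun e => hroot (List.mem_append_right _ (e ▸ hq))

theorem exists_match {σ : ℕ → BinTree ℕ} : ∀ {p : Pattern} {x : Value},
    p.subs.Nodup → Rep r J (p.subst σ) x → ∃ h : ℕ → Value,
      termVal h p.term = x ∧ MapsInto h (p.atoms r) J ∧
      ∀ v, leaf (Sum.inr v) ∈ p.subs → Rep r J (σ v) (h (2 * v + 2))
  | leaf (Sum.inl c), x, _, hx =>
    ⟨fun _ => x, Eq.symm hx, by simp [MapsInto, atoms], by simp [subs]⟩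
  | leaf (Sum.inr v), x, _, hx => by
    refine ⟨fun _ => x, rfl, by simp [MapsInto, atoms], fun w hw => ?_⟩
    obtain rfl : w = v := by simpa [subs] using hw
    exact hx
  | node a b, x, hn, ⟨y, z, hc, ha, hb⟩ => by
    obtain ⟨hna, hnb, -⟩ := List.nodup_append.1 (List.nodup_cons.1 hn).2
    obtain ⟨f, hfy, hfa, hfσ⟩ := exists_match hna ha
    obtain ⟨g, hgz, hgb, hgσ⟩ := exists_match hnb hb
    obtain ⟨h, hx, hf, hg⟩ := exists_glue hn x f g
    refine ⟨h, hx, mapsInto_atoms_node.2 ⟨?_, mapsInto_atoms_congr hfa hf,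
      mapsInto_atoms_congr hgb hg⟩, fun v hv => ?_⟩
    · rwa [hx, ← termVal_congr hf, ← termVal_congr hg, hfy, hgz]
    · rcases List.mem_append.1 (List.mem_of_ne_of_mem (by simp) hv) with hv | hv
      · exact (show f (2 * v + 2) = h (2 * v + 2) from hf _ hv) ▸ hfσ v hv
      · exact (show g (2 * v + 2) = h (2 * v + 2) from hg _ hv) ▸ hgσ v hv

/-- The children of a node are unique, and constants are not nodes. -/
structure Functional (r : ℕ) (J : Instance) : Prop where
  unique : ∀ x y z y' z', cell r x y z ∈ J → cell r x y' z' ∈ J → y = y' ∧ z = z'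
  null : ∀ c y z, cell r (Sum.inl c) y z ∉ J

theorem Rep.unique (hJ : Functional r J) : ∀ {s t : BinTree ℕ} {x : Value},
    Rep r J s x → Rep r J t x → s = t
  | leaf c, leaf d, x, h, h' => by
    rw [Sum.inl_injective (Eq.trans (Eq.symm h) h')]
  | leaf c, node a b, x, h, ⟨y, z, hc, _⟩ => by
    obtain rfl : x = Sum.inl c := h
    exact absurd hc (hJ.null _ _ _)
  | node a b, leaf c, x, ⟨y, z, hc, _⟩, h => by
    obtain rfl : x = Sum.inl c := h
    exact absurd hc (hJ.null _ _ _)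
  | node a b, node a' b', x, ⟨y, z, hc, ha, hb⟩, ⟨y', z', hc', ha', hb'⟩ => by
    obtain ⟨rfl, rfl⟩ := hJ.unique _ _ _ _ _ hc hc'
    rw [Rep.unique hJ ha ha', Rep.unique hJ hb hb']

theorem Functional.exists_rep (hJ : Functional r J) : ∀ {p : Pattern} {t : BinTree ℕ},
    MapsInto f (p.atoms r) J → Rep r J t (termVal f p.term) →
      ∀ q ∈ p.subs, ∃ s, Rep r J s (termVal f q.term)
  | leaf (Sum.inl _), _, _, _, q, hq => by simp [subs] at hq
  | leaf (Sum.inr _), t, _, ht, q, hq => ⟨t, by rwa [List.mem_singleton.1 hq]⟩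
  | node a b, leaf d, hf, ht, _, _ => by
    have hc := (mapsInto_atoms_node.1 hf).1
    rw [show termVal f (node a b).term = Sum.inl d from ht] at hc
    exact absurd hc (hJ.null _ _ _)
  | node a b, node c d, hf, ht, q, hq => by
    obtain ⟨hc, ha, hb⟩ := mapsInto_atoms_node.1 hf
    rcases List.mem_cons.1 hq with rfl | hq
    · exact ⟨_, ht⟩
    obtain ⟨y, z, hyz, hy, hz⟩ := ht
    obtain ⟨rfl, rfl⟩ := hJ.unique _ _ _ _ _ hyz hc
    exact (List.mem_append.1 hq).elim (hJ.exists_rep ha hy q) (hJ.exists_rep hb hz q)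

theorem Functional.exists_subst_eq (hJ : Functional r J) {t : BinTree ℕ}
    (hf : MapsInto f (p.atoms r) J) (ht : Rep r J t (termVal f p.term)) :
    ∃ σ, p.subst σ = t := by
  have hrep : ∀ v, ∃ s, leaf (Sum.inr v) ∈ p.subs → Rep r J s (f (2 * v + 2)) := fun v => by
    by_cases hv : leaf (Sum.inr v) ∈ p.subs
    · obtain ⟨s, hs⟩ := hJ.exists_rep hf ht _ hv
      exact ⟨s, fun _ => hs⟩
    · exact ⟨leaf 0, fun h => absurd h hv⟩
  choose σ hσ using hrep
  exact ⟨σ, Rep.unique hJ (rep_subst hf hσ) ht⟩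

theorem Functional.match_unique (hJ : Functional r J) : ∀ {p : Pattern},
    MapsInto f (p.atoms r) J → MapsInto g (p.atoms r) J →
      termVal f p.term = termVal g p.term →
      ∀ q ∈ p.subs, termVal f q.term = termVal g q.term
  | leaf (Sum.inl _), _, _, _, q, hq => by simp [subs] at hq
  | leaf (Sum.inr _), _, _, he, q, hq => by rwa [List.mem_singleton.1 hq]
  | node a b, hf, hg, he, q, hq => by
    obtain ⟨hfc, hfa, hfb⟩ := mapsInto_atoms_node.1 hf
    obtain ⟨hgc, hga, hgb⟩ := mapsInto_atoms_node.1 hg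
    obtain ⟨ha, hb⟩ := hJ.unique _ _ _ _ _ hfc (he ▸ hgc)
    rcases List.mem_cons.1 hq with rfl | hq
    · exact he
    · exact (List.mem_append.1 hq).elim (hJ.match_unique hfa hga ha q)
        (hJ.match_unique hfb hgb hb q)

theorem Functional.not_clash (hJ : Functional r J) : ∀ {p q : Pattern},
    MapsInto f (p.atoms r) J → MapsInto g (q.atoms r) J →
      termVal f p.term = termVal g q.term → ¬ clash p q
  | leaf (Sum.inl c), leaf (Sum.inl d), _, _, he => by simpa [clash] using Sum.inl_injective he
  | leaf (Sum.inl c), leaf (Sum.inr _), _, _, _ => by simp [clash]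
  | leaf (Sum.inr _), leaf _, _, _, _ => by simp [clash]
  | leaf (Sum.inr _), node _ _, _, _, _ => by simp [clash]
  | node _ _, leaf (Sum.inr _), _, _, _ => by simp [clash]
  | leaf (Sum.inl c), node _ _, _, hg, he =>
    absurd (he ▸ (mapsInto_atoms_node.1 hg).1) (hJ.null c _ _)
  | node _ _, leaf (Sum.inl c), hf, _, he =>
    absurd (he ▸ (mapsInto_atoms_node.1 hf).1) (hJ.null c _ _)
  | node a b, node c d, hf, hg, he => by
    obtain ⟨hfc, hfa, hfb⟩ := mapsInto_atoms_node.1 hf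
    obtain ⟨hgc, hga, hgb⟩ := mapsInto_atoms_node.1 hg
    obtain ⟨hac, hbd⟩ := hJ.unique _ _ _ _ _ hfc (he ▸ hgc)
    rw [clash, Bool.or_eq_true, not_or]
    exact ⟨hJ.not_clash hfa hga hac, hJ.not_clash hfb hgb hbd⟩

end Trees

/-! ### The tgds of a rewriting system -/

section RuleTGD

variable {R : List (Pattern × Pattern)} {ρ : Pattern × Pattern} {r v N : ℕ} {J : Instance}
  {f : ℕ → Value} {ξ : TGD} {t : Term} {p : Pattern}

/-- The tgd of a rewriting rule: a match of the left-hand side at the end of an edge requires an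
edge to a new copy of the right-hand side. Only the roots of configurations are ends of edges, so
the rule is not applied at inner nodes. -/
def ruleTGD (r : ℕ) (ρ : Pattern × Pattern) : TGD :=
  (edge r (Sum.inr 0) ρ.1.term :: ρ.1.atoms r, edge r ρ.1.term ρ.2.term :: ρ.2.atoms r)

/-- The tgd that creates a tree. -/
def initTGD (r : ℕ) (p : Pattern) : TGD := ([], edge r (Sum.inl 0) p.term :: p.atoms r)

/-- The tgd `ξ` attaches a new copy of the pattern `p` by an edge to the element `t`; its nodes that
are not new belong to the body. -/
structure Attaches (r : ℕ) (ξ : TGD) (t : Term) (p : Pattern) : Prop where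
  head : TGD.head ξ = edge r t p.term :: p.atoms r
  anchor : ∀ v, t = Sum.inr v → v ∈ varsOf (TGD.body ξ)
  root : ∃ n, p.term = Sum.inr n ∧ n ∉ varsOf (TGD.body ξ)
  shared : ∀ a b, node a b ∈ p.subs → ∀ v ∈ varsOf (TGD.body ξ), (node a b).term = Sum.inr v →
    cell r (node a b).term a.term b.term ∈ TGD.body ξ
  leaves : ∀ v, leaf (Sum.inr v) ∈ p.subs → 2 * v + 2 ∈ varsOf (TGD.body ξ)

theorem mapsInto_body_ruleTGD : MapsInto f (TGD.body (ruleTGD r ρ)) J ↔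
    edge r (f 0) (termVal f ρ.1.term) ∈ J ∧ MapsInto f (ρ.1.atoms r) J :=
  List.forall_mem_cons

theorem mapsInto_head_ruleTGD : MapsInto f (TGD.head (ruleTGD r ρ)) J ↔
    edge r (termVal f ρ.1.term) (termVal f ρ.2.term) ∈ J ∧ MapsInto f (ρ.2.atoms r) J :=
  List.forall_mem_cons

theorem mem_varsOf_body_ruleTGD :
    v ∈ varsOf (TGD.body (ruleTGD r ρ)) ↔ v = 0 ∨ ∃ q ∈ ρ.1.subs, q.term = Sum.inr v := by
  rw [← term_eq_inr_or_mem_varsOf_atoms (r := r)]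
  simp [mem_varsOf, TGD.body, ruleTGD, edge, Atom.args, or_assoc, eq_comm]

theorem mem_lhs_subs {q : Pattern} (hq : q.term = Sum.inr v)
    (hv : v ∈ varsOf (TGD.body (ruleTGD r ρ))) : q ∈ ρ.1.subs := by
  rcases mem_varsOf_body_ruleTGD.1 hv with rfl | ⟨q', hq', e⟩
  · exact absurd hq (term_ne_zero q)
  · exact term_injective (e.trans hq.symm) ▸ hq'

theorem attaches_initTGD (r : ℕ) (a b : BinTree ℕ) :
    Attaches r (initTGD r (ground (node a b))) (Sum.inl 0) (ground (node a b)) where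
  head := rfl
  anchor := nofun
  root := ⟨_, rfl, by simp [initTGD, TGD.body, varsOf]⟩
  shared := by simp [initTGD, TGD.body, varsOf]
  leaves := fun v hv => absurd hv (leaf_notMem_subs_ground v _)

theorem WellFormed.attaches_ruleTGD (hR : WellFormed R) (hρ : ρ ∈ R) (r : ℕ) :
    Attaches r (ruleTGD r ρ) ρ.1.term ρ.2 where
  head := rfl
  anchor := fun _ hv => mem_varsOf_body_ruleTGD.2
    (Or.inr (term_eq_inr_or_mem_varsOf_atoms (r := r).1 (Or.inl hv)))
  root := by
    obtain ⟨n, hn⟩ : ∃ n, ρ.2.term = Sum.inr n := by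
      rcases h : ρ.2 with _ | ⟨a, b⟩
      · simpa [h, isNode] using hR.rhs_isNode ρ hρ
      · exact ⟨_, rfl⟩
    exact ⟨n, hn, fun hb => hR.rhs_notMem ρ hρ (mem_lhs_subs hn hb)⟩
  shared := fun a b _ _ hv e =>
    List.mem_cons_of_mem _ (mem_atoms.2 ⟨a, b, mem_lhs_subs e hv, rfl⟩)
  leaves := fun _ hv => mem_varsOf_body_ruleTGD.2 (Or.inr ⟨_, hR.leaf_mem_lhs hρ hv, rfl⟩)

theorem mapsInto_fired (ξ : TGD) (f : ℕ → Value) (N : ℕ) (J : Instance) :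
    MapsInto (freshExt ξ f N) (TGD.head ξ) (J ∪ fired ξ f N) := fun α hα =>
  Finset.mem_union_right _ (mem_fired.2 ⟨α, hα, rfl⟩)

namespace Attaches

theorem freshExt_anchor (h : Attaches r ξ t p) : termVal (freshExt ξ f N) t = termVal f t := by
  rcases t with c | v
  · rfl
  · exact freshExt_of_mem (h.anchor v rfl)

theorem exists_freshExt_root (h : Attaches r ξ t p) (f : ℕ → Value) (N : ℕ) :
    ∃ n, termVal (freshExt ξ f N) p.term = Sum.inr (N + n) := by
  obtain ⟨n, hn, hnb⟩ := h.root
  exact ⟨n, by rw [hn]; exact freshExt_of_notMem hnb⟩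

theorem edge_mem_iff (h : Attaches r ξ t p) {x y : Value} :
    edge r x y ∈ J ∪ fired ξ f N ↔
      edge r x y ∈ J ∨ x = termVal f t ∧ y = termVal (freshExt ξ f N) p.term := by
  rw [Finset.mem_union, mem_fired, h.head]
  refine or_congr_right ⟨?_, ?_⟩
  · rintro ⟨α, hα, e⟩
    rcases List.mem_cons.1 hα with rfl | hα
    · rw [map_edge, edge_inj, h.freshExt_anchor] at e
      exact ⟨e.1.symm, e.2.symm⟩
    · obtain ⟨a, b, -, rfl⟩ := mem_atoms.1 hα
      exact absurd e cell_ne_edge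
  · rintro ⟨rfl, rfl⟩
    exact ⟨_, List.mem_cons_self, by rw [map_edge, h.freshExt_anchor]⟩

theorem cell_mem (h : Attaches r ξ t p) (hf : MapsInto f (TGD.body ξ) J) {x y z : Value}
    (hx : cell r x y z ∈ J ∪ fired ξ f N) : cell r x y z ∈ J ∨ ∃ a b n,
      (node a b).term = Sum.inr n ∧ x = Sum.inr (N + n) ∧
        y = termVal (freshExt ξ f N) a.term ∧ z = termVal (freshExt ξ f N) b.term := by
  rw [Finset.mem_union, mem_fired, h.head] at hx
  obtain hx | ⟨α, hα, e⟩ := hx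
  · exact Or.inl hx
  rcases List.mem_cons.1 hα with rfl | hα
  · exact absurd e.symm cell_ne_edge
  obtain ⟨a, b, hab, rfl⟩ := mem_atoms.1 hα
  obtain ⟨n, hn⟩ := exists_term_eq_inr hab
  by_cases hv : n ∈ varsOf (TGD.body ξ)
  · have hbody : MapsInto (freshExt ξ f N) (TGD.body ξ) J :=
      hf.congr fun v hv => (freshExt_of_mem hv).symm
    exact Or.inl (e ▸ hbody _ (h.shared a b hab n hv hn))
  · rw [map_cell, cell_inj] at e
    refine Or.inr ⟨a, b, n, hn, ?_, e.2.1.symm, e.2.2.symm⟩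
    rw [← e.1, hn]
    exact freshExt_of_notMem hv

theorem functional (h : Attaches r ξ t p) (hf : MapsInto f (TGD.body ξ) J)
    (hN : IndicesBelow N J) (hJ : Functional r J) : Functional r (J ∪ fired ξ f N) := by
  have fresh : ∀ n y z, cell r (Sum.inr (N + n)) y z ∉ J := fun n y z hc =>
    absurd (hN _ (mem_adom.2 ⟨_, hc, List.mem_cons_self⟩)) (by simp [rank, cell])
  constructor
  · intro x y z y' z' hyz hyz'
    rcases h.cell_mem hf hyz with hyz | ⟨a, b, n, hn, rfl, rfl, rfl⟩
    · rcases h.cell_mem hf hyz' with hyz' | ⟨a, b, n, -, rfl, -⟩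
      · exact hJ.unique _ _ _ _ _ hyz hyz'
      · exact absurd hyz (fresh _ _ _)
    · rcases h.cell_mem hf hyz' with hyz' | ⟨a', b', n', hn', hx, rfl, rfl⟩
      · exact absurd hyz' (fresh _ _ _)
      · obtain rfl : n = n' := by simpa using hx
        obtain ⟨rfl, rfl⟩ := node.inj (term_injective (hn.trans hn'.symm))
        exact ⟨rfl, rfl⟩
  · intro c y z hc
    rcases h.cell_mem hf hc with hc | ⟨_, _, _, -, hx, -⟩
    · exact hJ.null _ _ _ hc
    · cases hx

theorem rep (h : Attaches r ξ t p) {σ : ℕ → BinTree ℕ}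
    (hσ : ∀ v, leaf (Sum.inr v) ∈ p.subs → Rep r J (σ v) (f (2 * v + 2))) :
    Rep r (J ∪ fired ξ f N) (p.subst σ) (termVal (freshExt ξ f N) p.term) := by
  have hhead := mapsInto_fired ξ f N J
  rw [h.head] at hhead
  refine rep_subst (List.forall_mem_cons.1 hhead).2 fun v hv => ?_
  rw [freshExt_of_mem (h.leaves v hv)]
  exact (hσ v hv).mono Finset.subset_union_left

end Attaches

end RuleTGD

/-! ### Edge chains -/

section Chains

variable {r k N : ℕ} {J M : Instance} {f φ : ℕ → Value} {y : Value}

/-- Edges increase the rank. Hence they form no cycles, and the length of a path of edges is bounded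
by the rank of its end. -/
def Increasing (r : ℕ) (J : Instance) : Prop := ∀ x y, edge r x y ∈ J → rank x < rank y

theorem Attaches.increasing {ξ : TGD} {t : Term} {p : Pattern} (h : Attaches r ξ t p)
    (hf : MapsInto f (TGD.body ξ) J) (hN : IndicesBelow N J) (hJ : Increasing r J) :
    Increasing r (J ∪ fired ξ f N) := by
  intro x y hxy
  rcases h.edge_mem_iff.1 hxy with hxy | ⟨rfl, rfl⟩
  · exact hJ x y hxy
  have hanchor : rank (termVal f t) ≤ N := by
    rcases t with c | v
    · exact Nat.zero_le _
    · exact hN _ (hf.mem_adom (h.anchor v rfl))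
  obtain ⟨n, hn⟩ := h.exists_freshExt_root f N
  rw [hn]
  exact hanchor.trans_lt (Nat.lt_succ_of_le (Nat.le_add_right N n))

/-- `y` is the end of a path with `k` edges. -/
def Chain (r : ℕ) (J : Instance) : ℕ → Value → Prop
  | 0, _ => True
  | k + 1, y => ∃ x, edge r x y ∈ J ∧ Chain r J k x

namespace Chain

theorem map (hφ : Sends φ J M) :
    ∀ {k : ℕ} {y : Value}, Chain r J k y → Chain r M k (termVal φ y)
  | 0, _, _ => trivial
  | _ + 1, _, ⟨x, hx, hc⟩ => ⟨termVal φ x, hφ _ hx, map hφ hc⟩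

theorem mono (h : J ⊆ M) : ∀ {k : ℕ} {y : Value}, Chain r J k y → Chain r M k y
  | 0, _, _ => trivial
  | _ + 1, _, ⟨x, hx, hc⟩ => ⟨x, h hx, mono h hc⟩

theorem le_rank (hJ : Increasing r J) : ∀ {k : ℕ} {y : Value}, Chain r J k y → k ≤ rank y
  | 0, _, _ => Nat.zero_le _
  | _ + 1, _, ⟨_, hx, hc⟩ => Nat.succ_le_of_lt ((le_rank hJ hc).trans_lt (hJ _ _ hx))

theorem le_of_indicesBelow (hc : Chain r J k y) (hJ : Increasing r J) (hN : IndicesBelow N J) :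
    k ≤ N := by
  rcases k with _ | k
  · exact Nat.zero_le N
  · obtain ⟨x, hx, -⟩ := id hc
    exact (hc.le_rank hJ).trans
      (hN y (mem_adom.2 ⟨_, hx, List.mem_cons_of_mem _ List.mem_cons_self⟩))

end Chain

end Chains

/-! ### Runs of a rewriting system -/

section Runs

variable {r k : ℕ} {R : List (Pattern × Pattern)} {ρ : Pattern × Pattern} {I J J' : Instance}
  {f g : ℕ → Value} {a b s s' t : BinTree ℕ} {w x y : Value}

/-- The tgds for the runs of `R` from `t`. -/
def tgds (r : ℕ) (R : List (Pattern × Pattern)) (t : BinTree ℕ) : List TGD :=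
  initTGD r (ground t) :: R.map (ruleTGD r)

theorem mem_tgds {ξ : TGD} :
    ξ ∈ (tgds r R t).toFinset ↔ ξ = initTGD r (ground t) ∨ ∃ ρ ∈ R, ruleTGD r ρ = ξ := by
  simp [tgds]

/-- Some rule of `R` is applicable at the root `y` of a configuration in `J`, and the configuration
that follows is in `J` as well. -/
def Applied (r : ℕ) (R : List (Pattern × Pattern)) (J : Instance) (y : Value) : Prop :=
  ∃ ρ ∈ R, ∃ h, MapsInto h (TGD.body (ruleTGD r ρ)) J ∧ termVal h ρ.1.term = y ∧
    MapsInto h (TGD.head (ruleTGD r ρ)) J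

theorem Applied.mono (h : Applied r R J y) (hJ : J ⊆ J') : Applied r R J' y :=
  let ⟨ρ, hρ, e, hbody, hy, hhead⟩ := h
  ⟨ρ, hρ, e, hbody.mono hJ, hy, hhead.mono hJ⟩

/-- `J` is derived from `I` and contains a run of `R` of length `k` from `t` to the tree `s` with
root `x`, in which every rule has been applied to the earlier configurations. -/
structure IsRun (r : ℕ) (R : List (Pattern × Pattern)) (t : BinTree ℕ) (I J : Instance) (k : ℕ)
    (s : BinTree ℕ) (x : Value) : Prop where
  deriv : Deriv (tgds r R t).toFinset I J
  functional : Functional r J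
  rep : Rep r J s x
  init : ∃ e, MapsInto e (TGD.head (initTGD r (ground t))) J
  edges : ∀ w y, edge r w y ∈ J → y = x ∨ Applied r R J y
  chain : Chain r J (k + 1) x

theorem exists_isRun_zero (hI : ∀ α ∈ I, α.1 ≠ r) :
    ∃ J x, IsRun r R (node a b) I J 0 (node a b) x := by
  obtain ⟨N, hN⟩ := exists_indicesBelow I
  set ξ := initTGD r (ground (node a b))
  have hatt : Attaches r ξ _ _ := attaches_initTGD r a b
  let f : ℕ → Value := fun _ => Sum.inl 0
  have hf : MapsInto f (TGD.body ξ) I := nofun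
  have hrep := hatt.rep (J := I) (f := f) (N := N) (σ := fun _ => leaf 0)
    fun v hv => absurd hv (leaf_notMem_subs_ground v _)
  rw [subst_ground] at hrep
  refine ⟨I ∪ fired ξ f N, _, ?deriv, ?functional, hrep, ⟨_, mapsInto_fired ξ f N I⟩, ?edges,
    ⟨_, hatt.edge_mem_iff.2 (Or.inr ⟨rfl, rfl⟩), trivial⟩⟩
  case deriv => exact Deriv.refl.step ξ f N (mem_tgds.2 (Or.inl rfl)) hf hN
  case functional =>
    exact hatt.functional hf hN
      ⟨fun _ _ _ _ _ h => absurd rfl (hI _ h), fun _ _ _ h => hI _ h rfl⟩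
  case edges =>
    exact fun w y hwy =>
      (hatt.edge_mem_iff.1 hwy).elim (fun h => absurd rfl (hI _ h)) fun h => Or.inl h.2

theorem termVal_update_zero (g : ℕ → Value) (w : Value) (p : Pattern) :
    termVal (Function.update g 0 w) p.term = termVal g p.term := by
  rcases hp : p.term with c | v
  · rfl
  · have hv : v ≠ 0 := by
      rintro rfl
      exact term_ne_zero p hp
    exact Function.update_of_ne hv w g

theorem exists_mapsInto_body_ruleTGD {σ : ℕ → BinTree ℕ} (hn : ρ.1.subs.Nodup)
    (hw : edge r w x ∈ J) (hx : Rep r J (ρ.1.subst σ) x) :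
    ∃ f, MapsInto f (TGD.body (ruleTGD r ρ)) J ∧ termVal f ρ.1.term = x ∧
      ∀ v, leaf (Sum.inr v) ∈ ρ.1.subs → Rep r J (σ v) (f (2 * v + 2)) := by
  obtain ⟨g, hgx, hg, hgσ⟩ := exists_match hn hx
  have hupdate := termVal_update_zero g w
  refine ⟨Function.update g 0 w, mapsInto_body_ruleTGD.2 ⟨?_, ?_⟩, (hupdate _).trans hgx, hgσ⟩
  · rwa [hupdate, hgx, Function.update_self]
  · exact mapsInto_atoms_congr hg fun q _ => (hupdate q).symm

theorem IsRun.step (hR : WellFormed R) (h : IsRun r R t I J k s x) (hs : Rewrites R s s') :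
    ∃ J' x', IsRun r R t I J' (k + 1) s' x' := by
  obtain ⟨ρ, hρ, σ, rfl, rfl⟩ := hs
  obtain ⟨w, hw, -⟩ := h.chain
  obtain ⟨f, hf, rfl, hfσ⟩ := exists_mapsInto_body_ruleTGD (hR.lhs_linear ρ hρ) hw h.rep
  obtain ⟨N, hN⟩ := exists_indicesBelow J
  set ξ := ruleTGD r ρ
  have hatt : Attaches r ξ _ _ := hR.attaches_ruleTGD hρ r
  have hsub : J ⊆ J ∪ fired ξ f N := Finset.subset_union_left
  have happlied : Applied r R (J ∪ fired ξ f N) (termVal f ρ.1.term) :=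
    ⟨ρ, hρ, freshExt ξ f N, (hf.congr fun v hv => (freshExt_of_mem hv).symm).mono hsub,
      hatt.freshExt_anchor, mapsInto_fired ξ f N J⟩
  refine ⟨J ∪ fired ξ f N, _, ?deriv, hatt.functional hf hN h.functional,
    hatt.rep fun v hv => hfσ v (hR.leaf_mem_lhs hρ hv), ?init, fun w' y hwy => ?edges,
    ⟨_, hatt.edge_mem_iff.2 (Or.inr ⟨rfl, rfl⟩), h.chain.mono hsub⟩⟩
  case deriv => exact h.deriv.step ξ f N (mem_tgds.2 (Or.inr ⟨ρ, hρ, rfl⟩)) hf hN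
  case init => exact h.init.imp fun e he => he.mono hsub
  case edges =>
    rcases hatt.edge_mem_iff.1 hwy with hwy | ⟨-, rfl⟩
    · rcases h.edges w' y hwy with rfl | hy
      · exact Or.inr happlied
      · exact Or.inr (hy.mono hsub)
    · exact Or.inl rfl

theorem Functional.hasExtension_ruleTGD (hJ : Functional r J)
    (hf : MapsInto f (TGD.body (ruleTGD r ρ)) J) (hg : MapsInto g (TGD.body (ruleTGD r ρ)) J)
    (hfg : termVal g ρ.1.term = termVal f ρ.1.term)
    (hhead : MapsInto g (TGD.head (ruleTGD r ρ)) J) :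
    HasExtension (ruleTGD r ρ) f J := by
  have hupdate := termVal_update_zero g (f 0)
  refine ⟨Function.update g 0 (f 0), fun v hv => ?_, mapsInto_head_ruleTGD.2 ⟨?_, ?_⟩⟩
  · rcases mem_varsOf_body_ruleTGD.1 hv with rfl | ⟨q, hq, hqv⟩
    · exact Function.update_self ..
    · have hgq := (hupdate q).trans (hJ.match_unique (mapsInto_body_ruleTGD.1 hg).2
        (mapsInto_body_ruleTGD.1 hf).2 hfg q hq)
      rwa [hqv] at hgq
  · rw [hupdate, hupdate]
    exact (mapsInto_head_ruleTGD.1 hhead).1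
  · exact mapsInto_atoms_congr (mapsInto_head_ruleTGD.1 hhead).2 fun q _ => (hupdate q).symm

theorem IsRun.model (hR : WellFormed R) (h : IsRun r R t I J k s x)
    (hs : ∀ s', ¬ Rewrites R s s') : Model (tgds r R t).toFinset J := by
  intro ξ hξ f hf
  rcases mem_tgds.1 hξ with rfl | ⟨ρ, hρ, rfl⟩
  · obtain ⟨e, he⟩ := h.init
    exact ⟨e, by simp [initTGD, TGD.body, varsOf], he⟩
  obtain ⟨hedge, hatoms⟩ := mapsInto_body_ruleTGD.1 hf
  rcases h.edges _ _ hedge with hx | ⟨ρ', hρ', g, hg, hgf, hhead⟩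
  · obtain ⟨σ, hσ⟩ := h.functional.exists_subst_eq hatoms (hx ▸ h.rep)
    exact absurd ⟨ρ, hρ, σ, hσ, rfl⟩ (hs _)
  · obtain rfl : ρ' = ρ := (hR.clash ρ' hρ' ρ hρ).resolve_right
      (h.functional.not_clash (mapsInto_body_ruleTGD.1 hg).2 hatoms hgf)
    exact h.functional.hasExtension_ruleTGD hf hg hgf hhead

theorem Deriv.increasing (hR : WellFormed R) (hI : ∀ α ∈ I, α.1 ≠ r)
    (h : Deriv (tgds r R (node a b)).toFinset I J) : Increasing r J := by
  induction h with
  | refl => exact fun x y hxy => absurd rfl (hI _ hxy)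
  | step ξ f N _ hξ hf hN ih =>
    rcases mem_tgds.1 hξ with rfl | ⟨ρ, hρ, rfl⟩
    · exact (attaches_initTGD r a b).increasing hf hN ih
    · exact (hR.attaches_ruleTGD hρ r).increasing hf hN ih

theorem exists_halting_of_coreChaseTerminates (hR : WellFormed R) (hI : ∀ α ∈ I, α.1 ≠ r)
    (hterm : CoreChaseTerminates (tgds r R (node a b)).toFinset I) :
    ∃ s, Relation.ReflTransGen (Rewrites R) (node a b) s ∧ ∀ s', ¬ Rewrites R s s' := by
  by_contra! hno
  have hrun : ∀ k, ∃ J s x, Relation.ReflTransGen (Rewrites R) (node a b) s ∧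
      IsRun r R (node a b) I J k s x := by
    intro k
    induction k with
    | zero =>
      obtain ⟨J, x, h⟩ := exists_isRun_zero (R := R) (a := a) (b := b) hI
      exact ⟨J, _, x, .refl, h⟩
    | succ k ih =>
      obtain ⟨J, s, x, hs, h⟩ := ih
      obtain ⟨s', hs'⟩ := hno s hs
      obtain ⟨J', x', h'⟩ := h.step hR hs'
      exact ⟨J', s', x', hs.tail hs', h'⟩
  obtain ⟨J, U, hJ, ⟨ψ, hψ⟩, hIU, hU⟩ := coreChaseTerminates_iff.1 hterm
  obtain ⟨N, hN⟩ := exists_indicesBelow J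
  obtain ⟨J', s, x, -, h⟩ := hrun N
  obtain ⟨φ, hφ⟩ := h.deriv.homTo_model hIU hU
  have hchain : Chain r J (N + 1) _ := (h.chain.map hφ).map hψ
  exact absurd (hchain.le_of_indicesBelow (hJ.increasing hR hI) hN) (Nat.not_succ_le_self N)

theorem coreChaseTerminates_of_halting (hR : WellFormed R) (hI : ∀ α ∈ I, α.1 ≠ r)
    (hs : Relation.ReflTransGen (Rewrites R) (node a b) s) (hhalt : ∀ s', ¬ Rewrites R s s') :
    CoreChaseTerminates (tgds r R (node a b)).toFinset I := by
  have hrun : ∃ J k x, IsRun r R (node a b) I J k s x := by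
    clear hhalt
    induction hs with
    | refl =>
      obtain ⟨J, x, h⟩ := exists_isRun_zero (R := R) (a := a) (b := b) hI
      exact ⟨J, 0, x, h⟩
    | tail _ hs' ih =>
      obtain ⟨J, k, x, h⟩ := ih
      obtain ⟨J', x', h'⟩ := h.step hR hs'
      exact ⟨J', k + 1, x', h'⟩
  obtain ⟨J, k, x, h⟩ := hrun
  exact coreChaseTerminates_iff.2
    ⟨J, J, h.deriv, HomTo.refl J, HomTo.of_subset h.deriv.subset, h.model hR hhalt⟩

theorem coreChaseTerminates_tgds_iff (hR : WellFormed R) (hI : ∀ α ∈ I, α.1 ≠ r)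
    (a b : BinTree ℕ) : CoreChaseTerminates (tgds r R (node a b)).toFinset I ↔
      ∃ s, Relation.ReflTransGen (Rewrites R) (node a b) s ∧ ∀ s', ¬ Rewrites R s s' :=
  ⟨exists_halting_of_coreChaseTerminates hR hI,
    fun ⟨_, hs, hhalt⟩ => coreChaseTerminates_of_halting hR hI hs hhalt⟩

end Runs

/-! ### The reduction -/

section Reduction

variable (r : ℕ)

/-- The root and the atoms of a pattern, the part of a tgd that a pattern contributes. -/
def packed (p : Pattern) : Term × List (Atom Term) := (p.term, p.atoms r)

/-- `packed` for a node, computed from the values for its children. -/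
def packedNode (P Q : Term × List (Atom Term)) : Term × List (Atom Term) :=
  (nodeTerm P.1 Q.1, cell r (nodeTerm P.1 Q.1) P.1 Q.1 :: (P.2 ++ Q.2))

theorem packed_ground_node (a b : BinTree ℕ) : packed r (ground (node a b)) =
    packedNode r (packed r (ground a)) (packed r (ground b)) := rfl

theorem primrec_nodeTerm : Primrec₂ nodeTerm :=
  Primrec.sumInr.comp (Primrec.succ.comp (Primrec.nat_mul.comp (Primrec.const 2) Primrec.encode))

theorem primrec_packedNode : Primrec₂ (packedNode r) := by
  have hleft : Primrec fun P : (Term × List (Atom Term)) × (Term × List (Atom Term)) => P.1.1 :=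
    Primrec.fst.comp Primrec.fst
  have hright : Primrec fun P : (Term × List (Atom Term)) × (Term × List (Atom Term)) => P.2.1 :=
    Primrec.fst.comp Primrec.snd
  have hroot := primrec_nodeTerm.comp hleft hright
  have hcell := (Primrec.const r).pair (hroot.pair
    (Primrec.list_cons.comp hleft (Primrec.list_cons.comp hright (Primrec.const []))))
  exact hroot.pair (Primrec.list_cons.comp hcell
    (Primrec.list_append.comp (Primrec.snd.comp Primrec.fst) (Primrec.snd.comp Primrec.snd)))

theorem primrec_packed_ground_node {f g : ℕ → BinTree ℕ}
    (hf : Primrec fun n => packed r (ground (f n)))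
    (hg : Primrec fun n => packed r (ground (g n))) :
    Primrec fun n => packed r (ground (node (f n) (g n))) := by
  simpa only [packed_ground_node] using (primrec_packedNode r).comp hf hg

theorem primrec_packed_ground_natTree : Primrec fun n => packed r (ground (natTree n)) := by
  have hrec := Primrec.nat_rec₁ (packed r (ground (leaf 0)))
    ((primrec_packedNode r).comp (Primrec.const (packed r (ground (leaf 0)))) Primrec.snd).to₂
  refine hrec.of_eq fun n => ?_
  induction n with
  | zero => rfl
  | succ n ih => rw [natTree, packed_ground_node, ← ih]

theorem primrec_packed_ground_evalTree (c : Code) :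
    Primrec fun n => packed r (ground (evalTree c .halt [n])) := by
  have hconst (t : BinTree ℕ) : Primrec fun _ : ℕ => packed r (ground t) := Primrec.const _
  have hinput : Primrec fun n => packed r (ground (listTree [n])) :=
    primrec_packed_ground_node r (primrec_packed_ground_natTree r) (hconst (leaf 0))
  exact primrec_packed_ground_node r (hconst _) (primrec_packed_ground_node r (hconst _)
    (primrec_packed_ground_node r (hconst _) hinput))

theorem computable_tgds (R : List (Pattern × Pattern)) (c : Code) :
    Computable fun n => tgds r R (evalTree c .halt [n]) := by
  have htree := primrec_packed_ground_evalTree r c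
  have hedge := (Primrec.const r).pair ((Primrec.const (Sum.inl 0 : Term)).pair
    (Primrec.list_cons.comp (Primrec.fst.comp htree) (Primrec.const [])))
  have hinit : Primrec fun n => initTGD r (ground (evalTree c .halt [n])) :=
    (Primrec.const []).pair (Primrec.list_cons.comp hedge (Primrec.snd.comp htree))
  exact (Primrec.list_cons.comp hinit (Primrec.const _)).to_comp

end Reduction

theorem exists_code_dom {q : ℕ → Prop} (hq : REPred q) :
    ∃ c : Code, ∀ n, (c.eval [n]).Dom ↔ q n := by
  have hpart : Partrec fun n => (Part.assert (q n) fun _ => Part.some ()).map fun _ => 0 :=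
    Partrec.map hq (Computable.const 0).to₂
  obtain ⟨c, hc⟩ := Code.exists_code (Nat.Partrec'.part_iff₁.2 hpart)
  refine ⟨c, fun n => ?_⟩
  have heval : c.eval [n] = _ := hc (n ::ᵥ List.Vector.nil)
  rw [heval]
  exact exists_prop.trans (and_iff_left trivial)

theorem exists_reduction (I : Instance) {q : ℕ → Prop} (hq : REPred q) :
    ∃ f : ℕ → List TGD, Computable f ∧ ∀ n, q n ↔ (f n).toFinset ∈ CTcore I := by
  obtain ⟨c, hc⟩ := exists_code_dom hq
  obtain ⟨r, hr⟩ := Infinite.exists_notMem_finset (I.image Prod.fst)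
  have hI : ∀ α ∈ I, α.1 ≠ r := fun α hα e => hr (Finset.mem_image.2 ⟨α, hα, e⟩)
  refine ⟨_, computable_tgds r Interpreter.rules c, fun n => ?_⟩
  rw [← hc n, Interpreter.eval_dom_iff]
  exact (coreChaseTerminates_tgds_iff Interpreter.wellFormed_rules hI _ _).symm

end CoreChase

/-- Finite sets of tgds, and in the second part also instances, are given to the machine as lists of
their elements. -/
theorem mainTheorem6 :
    (∀ I : CoreChase.Instance,
      CoreChase.REComplete fun S : List CoreChase.TGD => S.toFinset ∈ CoreChase.CTcore I) ∧
    CoreChase.REComplete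
      fun P : List (CoreChase.Atom CoreChase.Value) × List CoreChase.TGD =>
        P.2.toFinset ∈ CoreChase.CTcore P.1.toFinset := by
  refine ⟨fun I => ⟨CoreChase.rePred_mem_CTcore_of_instance I, fun q hq => ?_⟩,
    CoreChase.rePred_mem_CTcore, fun q hq => ?_⟩
  · exact CoreChase.exists_reduction I hq
  · obtain ⟨f, hf, hqf⟩ := CoreChase.exists_reduction ∅ hq
    exact ⟨fun n => ([], f n), (Computable.const []).pair hf, fun n => by simpa using hqf n⟩
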